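/- Let $\mathbb F_q$ be a finite field, $C$ a smooth projective geometrically irreducible curve over $\mathbb F_q$ with function field $Q$, $\infty\in C(\mathbb F_q)$ a rational point, and $A=\Gamma(C\setminus\{\infty\},\mathcal O_C)$. Let $L\supset\mathbb F_q$ be a field, $C_L=C\times_{\mathbb F_q}L$, $A_L=A\otimes_{\mathbb F_q}L$, let $\sigma$ be the endomorphism of $C_L$ that is the identity on $C$ and the $q$-Frobenius on $L$, so that $\sigma^*(a\otimes b)=a\otimes b^q$ on $A_L$, and write $\sigma^*M=M\otimes_{A_L,\sigma^*}A_L$ for an $A_L$-module $M$. Let $c^*:A\to L$ be an $\mathbb F_q$-algebra homomorphism and let $J\subset A_L$ be the ideal generated by all $a\otimes 1-1\otimes c^*(a)$, $a\in A$. A pure Anderson motive $\underline M=(M,\tau)$ over $L$ (of characteristic $c^*$, some rank $r$ and some dimension $d$) consists of a locally free $A_L$-module $M$ of finite rank $r$ and an injective $A_L$-linear map $\tau:\sigma^*M\to M$ such that (1) $\operatorname{coker}\tau$ has dimension $d$ over $L$ and is annihilated by $J^d$, and (2) $M$ extends to a locally free sheaf $\mathcal M$ of rank $r$ on $C_L$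 such that for some integers $k,l>0$ the map $\tau^l:=\tau\circ\sigma^*(\tau)\circ\cdots\circ(\sigma^*)^{l-1}(\tau):(\sigma^*)^lM\to M$ induces an isomorphism of stalks $(\sigma^*)^l\mathcal M_\infty\to\mathcal M(k\cdot\infty)_\infty$ at $\infty$. A morphism $f:(M,\tau)\to(M',\tau')$ of pure Anderson motives of characteristic $c^*$ is an $A_L$-linear map $f:M\to M'$ with $f\circ\tau=\tau'\circ\sigma^*(f)$; it is an isogeny if it is injective with torsion cokernel. Let $\underline M$ be a pure Anderson motive over $L$ of characteristic $c^*$, and let $E=\operatorname{End}(\underline M)\otimes_AQ$. An $A$-order in $E$ is a subring of $E$ (with the same unit) that is a finitely generated $A$-submodule of $E$ and spans $E$ over $Q$; it is a maximal order if it is not properly contained in another $A$-order. For an isogeny $f:\underline M'\to\underline M$ let $f^{-1}=g\otimes a^{-1}\in\operatorname{Hom}(\underline M,\underline M')\otimes_AQ$, where $0\ne a\in A$ and $g:\underline M\to\underline M'$ is a morphism with $f\circ g=a$ and $g\circ f=a$, so that $f\cdot\operatorname{End}(\underline M')\cdot f^{-1}\subset E$. Theorem. For every maximal order $S$ in $E$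 there are a pure Anderson motive $\underline M'$ over $L$ of characteristic $c^*$ and an isogeny $f:\underline M'\to\underline M$ such that $$S=f\cdot\operatorname{End}(\underline M')\cdot f^{-1}.$$ -/

import Mathlib

open scoped TensorProduct nonZeroDivisors

universe u v w x

noncomputable section

namespace AndersonMotive

/-! ### Frobenius pullback -/

section Pullback

/-- The ring `R`, regarded as an `R`-algebra through the endomorphism `s`. -/
def Twist {R : Type u} [CommRing R] (_s : R →+* R) : Type u := R

variable {R : Type u} [CommRing R] (s : R →+* R)

instance : CommRing (Twist s) := inferInstanceAs (CommRing R)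

instance : Algebra R (Twist s) := RingHom.toAlgebra (S := R) s

/-- `s^* M = M ⊗_{R,s} R`, an `R`-module through the factor `R`. -/
def Pullback (M : Type v) [AddCommGroup M] [Module R M] : Type (max u v) := Twist s ⊗[R] M

variable (M : Type v) [AddCommGroup M] [Module R M]

instance : AddCommGroup (Pullback s M) := inferInstanceAs (AddCommGroup (Twist s ⊗[R] M))

instance : Module R (Pullback s M) := inferInstanceAs (Module (Twist s) (Twist s ⊗[R] M))

variable {M}

/-- The element `m ⊗ 1` of `s^* M`. -/
def Pullback.of (m : M) : Pullback s M := (1 : Twist s) ⊗ₜ[R] m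

/-- The pullback `s^* f : s^* M → s^* N` of a linear map `f : M → N`. -/
def Pullback.map {N : Type w} [AddCommGroup N] [Module R N] (f : M →ₗ[R] N) :
    Pullback s M →ₗ[R] Pullback s N :=
  (TensorProduct.AlgebraTensorModule.map (LinearMap.id : Twist s →ₗ[Twist s] Twist s) f :
    Twist s ⊗[R] M →ₗ[Twist s] Twist s ⊗[R] N)

lemma Pullback.of_add (m m' : M) : Pullback.of s (m + m') = .of s m + .of s m' :=
  TensorProduct.tmul_add _ _ _

lemma Pullback.of_zero : Pullback.of s (0 : M) = 0 :=
  TensorProduct.tmul_zero _ _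

lemma Pullback.of_smul (a : R) (m : M) : Pullback.of s (a • m) = s a • .of s m := by
  exact (TensorProduct.smul_tmul a (1 : Twist s) m).symm

lemma Pullback.map_of {N : Type w} [AddCommGroup N] [Module R N] (f : M →ₗ[R] N) (m : M) :
    Pullback.map s f (.of s m) = .of s (f m) := rfl

lemma Pullback.induction {P : Pullback s M → Prop} (y : Pullback s M)
    (h : ∀ (a : R) (m : M), P (a • .of s m)) (hadd : ∀ y y', P y → P y' → P (y + y')) : P y := by
  have h0 : P 0 := by
    have := h 0 0
    rwa [zero_smul] at this
  have h' : ∀ (a : Twist s) (m : M), P (a ⊗ₜ[R] m) := fun a m => by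
    have e : a ⊗ₜ[R] m = (show R from a) • Pullback.of s m :=
      congrArg (· ⊗ₜ[R] m) (mul_one (show R from a)).symm
    exact e ▸ h a m
  exact TensorProduct.induction_on (motive := P) y h0 h' hadd

lemma Pullback.map_ext {N : Type w} [AddCommGroup N] [Module R N]
    {f g : Pullback s M →ₗ[R] N} (h : ∀ m, f (.of s m) = g (.of s m)) : f = g := by
  refine LinearMap.ext fun y => ?_
  induction y using Pullback.induction with
  | h a m => rw [map_smul, map_smul, h]
  | hadd y y' hy hy' => rw [map_add, map_add, hy, hy']

lemma Pullback.map_one (y : Pullback s M) :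
    Pullback.map s (1 : Module.End R M) y = y :=
  LinearMap.congr_fun (f := Pullback.map s (1 : Module.End R M)) (g := LinearMap.id) (Pullback.map_ext s fun _ => rfl) y

lemma Pullback.map_mul (f g : Module.End R M) (y : Pullback s M) :
    Pullback.map s (f * g) y = Pullback.map s f (Pullback.map s g y) :=
  LinearMap.congr_fun (f := Pullback.map s (f * g)) (g := Pullback.map s f ∘ₗ Pullback.map s g)
    (Pullback.map_ext s fun _ => rfl) y

lemma Pullback.map_zero (y : Pullback s M) :
    Pullback.map s (0 : Module.End R M) y = 0 :=
  LinearMap.congr_fun (g := 0) (Pullback.map_ext s fun _ => Pullback.of_zero s) y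

lemma Pullback.map_add (f g : Module.End R M) (y : Pullback s M) :
    Pullback.map s (f + g) y = Pullback.map s f y + Pullback.map s g y :=
  LinearMap.congr_fun (g := Pullback.map s f + Pullback.map s g)
    (Pullback.map_ext s fun _ => Pullback.of_add s _ _) y

lemma Pullback.map_neg (f : Module.End R M) (y : Pullback s M) :
    Pullback.map s (-f) y = -Pullback.map s f y := by
  rw [eq_neg_iff_add_eq_zero, ← Pullback.map_add, neg_add_cancel, Pullback.map_zero]

lemma Pullback.map_algebraMap (a : R) (y : Pullback s M) :
    Pullback.map s (algebraMap R (Module.End R M) a) y = s a • y :=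
  LinearMap.congr_fun (g := s a • LinearMap.id)
    (Pullback.map_ext s fun _ => Pullback.of_smul s _ _) y

end Pullback

/-! ### The curve

A smooth projective geometrically irreducible curve `C` over the finite field `Fq` is given by its
function field `Q`; the closed points of `C` are the places of `Q / Fq`, and the local ring of `C`
at a closed point is the valuation ring of the place. -/

/-- `Q` is the function field of a smooth projective geometrically irreducible curve over the
(finite, hence perfect) field `Fq`: it is a function field in one variable over `Fq` in which `Fq`
is algebraically closed. -/
structure IsCurveFunctionField (Fq : Type u) (Q : Type v) [Field Fq] [Field Q] [Algebra Fq Q] :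
    Prop where
  exists_finite : ∃ t : Q, Transcendental Fq t ∧
    FiniteDimensional (IntermediateField.adjoin Fq {t}) Q
  mem_of_isAlgebraic : ∀ y : Q, IsAlgebraic Fq y → y ∈ (algebraMap Fq Q).range

/-- A place of `Q / Fq`, that is, a closed point of the curve: a valuation ring of `Q` which
contains `Fq` and is different from `Q`. -/
structure Place (Fq : Type u) (Q : Type v) [Field Fq] [Field Q] [Algebra Fq Q] where
  /-- the local ring of the curve at the point -/
  ring : ValuationSubring Q
  algebraMap_mem : ∀ a : Fq, algebraMap Fq Q a ∈ ring
  ne_top : ring ≠ ⊤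

section Curve

variable {Fq : Type u} {Q : Type v} [Field Fq] [Field Q] [Algebra Fq Q]

instance Place.instAlgebra (P : Place Fq Q) : Algebra Fq P.ring :=
  ((algebraMap Fq Q).codRestrict P.ring.toSubring P.algebraMap_mem).toAlgebra

/-- The inclusion of the local ring at `P` into the function field. -/
def Place.incl (P : Place Fq Q) : P.ring →ₐ[Fq] Q :=
  { P.ring.subtype with commutes' := fun _ => rfl }

/-- The reduction map from the local ring at `P` to the residue field at `P`. -/
def Place.residue (P : Place Fq Q) : P.ring →ₐ[Fq] IsLocalRing.ResidueField P.ring :=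
  { IsLocalRing.residue P.ring with commutes' := fun _ => rfl }

/-- The point `P` is `Fq`-rational: its residue field is `Fq`. -/
def Place.IsRational (P : Place Fq Q) : Prop :=
  Function.Bijective (algebraMap Fq (IsLocalRing.ResidueField P.ring))

/-- The ring `A = Γ(C ∖ {∞}, 𝒪_C)` of functions that are regular at all points other than `∞`. -/
def regularAway (inf : Place Fq Q) : Subalgebra Fq Q where
  carrier := {y | ∀ P : Place Fq Q, P ≠ inf → y ∈ P.ring}
  mul_mem' ha hb P hP := mul_mem (ha P hP) (hb P hP)
  add_mem' ha hb P hP := add_mem (ha P hP) (hb P hP)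
  algebraMap_mem' a P _ := P.algebraMap_mem a

end Curve

section BaseChange

variable {Fq : Type u} {Q : Type v} [Field Fq] [Field Q] [Algebra Fq Q]
variable (inf : Place Fq Q) (L : Type w) [Field L] [Algebra Fq L]

/-- `A_L = A ⊗ L`. -/
abbrev AL : Type (max v w) := regularAway inf ⊗[Fq] L

variable (Fq) in
/-- The endomorphism `σ^* = id ⊗ Frob_q` of `B ⊗ L`, for an `Fq`-algebra `B`. -/
def frob [Fintype Fq] (B : Type x) [CommRing B] [Algebra Fq B] : B ⊗[Fq] L →+* B ⊗[Fq] L :=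
  (Algebra.TensorProduct.map (AlgHom.id Fq B) (FiniteField.frobeniusAlgHom Fq L)).toRingHom

/-- The ideal `J ⊆ A_L` generated by `a ⊗ 1 - 1 ⊗ c(a)`, for `a ∈ A`. -/
def idealJ (c : regularAway inf →ₐ[Fq] L) : Ideal (AL inf L) :=
  Ideal.span (Set.range fun a : regularAway inf => a ⊗ₜ[Fq] (1 : L) - 1 ⊗ₜ[Fq] c a)

variable (Fq Q) in
/-- The function field of `C_L`: the field of fractions of the domain `Q ⊗ L`. -/
def FunctionFieldL : Type (max v w) := FractionRing (Q ⊗[Fq] L)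

instance : CommRing (FunctionFieldL Fq Q L) := inferInstanceAs (CommRing (FractionRing _))

variable (Fq Q) in
/-- The inclusion of `Q ⊗ L` into the function field of `C_L`. -/
def inclQL : Q ⊗[Fq] L →+* FunctionFieldL Fq Q L :=
  algebraMap (Q ⊗[Fq] L) (FractionRing (Q ⊗[Fq] L))

instance : Algebra (Q ⊗[Fq] L) (FunctionFieldL Fq Q L) :=
  inferInstanceAs (Algebra (Q ⊗[Fq] L) (FractionRing (Q ⊗[Fq] L)))

instance : IsFractionRing (Q ⊗[Fq] L) (FunctionFieldL Fq Q L) :=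
  inferInstanceAs (IsLocalization (Q ⊗[Fq] L)⁰ (FractionRing (Q ⊗[Fq] L)))

instance : Algebra (AL inf L) (FunctionFieldL Fq Q L) :=
  ((inclQL Fq Q L).comp (Algebra.TensorProduct.map (regularAway inf).val
    (AlgHom.id Fq L)).toRingHom).toAlgebra

lemma frob_mem_nonZeroDivisors [Fintype Fq] {y : Q ⊗[Fq] L} (hy : y ∈ (Q ⊗[Fq] L)⁰) :
    frob Fq L Q y ∈ (Q ⊗[Fq] L)⁰ := by
  have hflat : (frob Fq L Q).Flat :=
    RingHom.Flat.tensorProductMap (f := AlgHom.id Fq Q) (g := FiniteField.frobeniusAlgHom Fq L)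
      (RingHom.Flat.id _) (RingHom.Flat.of_isField (Field.toIsField L) _)
  have : Module.Flat (Q ⊗[Fq] L) (Twist (frob Fq L Q)) := hflat
  have h := Module.Flat.isSMulRegular_of_nonZeroDivisors (M := Twist (frob Fq L Q)) hy
  refine mem_nonZeroDivisors_iff_right.mpr fun t ht => ?_
  refine h (?_ : y • (show Twist (frob Fq L Q) from t) = y • (0 : Twist (frob Fq L Q)))
  rw [smul_zero]
  exact (mul_comm _ _).trans ht

variable (Fq Q) in
/-- The endomorphism `σ^*` of the function field of `C_L`. -/
def frobFunctionField [Fintype Fq] : FunctionFieldL Fq Q L →+* FunctionFieldL Fq Q L :=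
  IsLocalization.map (M := (Q ⊗[Fq] L)⁰) (T := (Q ⊗[Fq] L)⁰)
    (FunctionFieldL Fq Q L) (frob Fq L Q) (fun _ h => frob_mem_nonZeroDivisors L h)

lemma frobFunctionField_smul [Fintype Fq] (a : AL inf L) (y : FunctionFieldL Fq Q L) :
    frobFunctionField Fq Q L (a • y) =
      frob Fq L (regularAway inf) a • frobFunctionField Fq Q L y := by
  have key : ∀ a : AL inf L,
      frob Fq L Q (Algebra.TensorProduct.map (regularAway inf).val (AlgHom.id Fq L) a) =
      Algebra.TensorProduct.map (regularAway inf).val (AlgHom.id Fq L)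
        (frob Fq L (regularAway inf) a) := by
    intro a
    induction a using TensorProduct.induction_on with
    | zero => simp
    | tmul a l => simp [frob]
    | add a a' h h' => simp only [map_add, h, h']
  have h : ∀ w : Q ⊗[Fq] L,
      frobFunctionField Fq Q L (inclQL Fq Q L w) = inclQL Fq Q L (frob Fq L Q w) :=
    fun w => IsLocalization.map_eq _ w
  rw [Algebra.smul_def, Algebra.smul_def, map_mul]
  congr 1
  change frobFunctionField Fq Q L (inclQL Fq Q L _) = inclQL Fq Q L _
  rw [h]
  exact congrArg _ (key a)

/-- The map from `𝒪_{C,∞} ⊗ L` to the function field of `C_L`. -/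
def inclLocal : inf.ring ⊗[Fq] L →+* FunctionFieldL Fq Q L :=
  (inclQL Fq Q L).comp (Algebra.TensorProduct.map inf.incl (AlgHom.id Fq L)).toRingHom

/-- The elements of `𝒪_{C,∞} ⊗ L` which do not vanish at `∞`, that is, whose value in
`κ(∞) ⊗ L` (which is `L` if `∞` is rational) is a unit. -/
def nonvanishing : Submonoid (inf.ring ⊗[Fq] L) :=
  (IsUnit.submonoid (IsLocalRing.ResidueField inf.ring ⊗[Fq] L)).comap
    (Algebra.TensorProduct.map inf.residue (AlgHom.id Fq L))

/-- The stalk `𝒪_{C_L,∞}` as a subring of the function field of `C_L`: the fractions `a / t` with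
`a, t ∈ 𝒪_{C,∞} ⊗ L` such that `t` does not vanish at `∞`. -/
def stalk : Subring (FunctionFieldL Fq Q L) where
  carrier := {y | ∃ a, ∃ t ∈ nonvanishing inf L, y * inclLocal inf L t = inclLocal inf L a}
  mul_mem' := by
    rintro y y' ⟨a, t, ht, h⟩ ⟨a', t', ht', h'⟩
    exact ⟨a * a', t * t', mul_mem ht ht', by rw [map_mul, map_mul, ← h, ← h']; ring⟩
  one_mem' := ⟨1, 1, one_mem _, by simp⟩
  add_mem' := by
    rintro y y' ⟨a, t, ht, h⟩ ⟨a', t', ht', h'⟩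
    refine ⟨a * t' + a' * t, t * t', mul_mem ht ht', ?_⟩
    rw [map_mul, map_add, map_mul, map_mul, ← h, ← h']; ring
  zero_mem' := ⟨0, 1, one_mem _, by simp⟩
  neg_mem' := by
    rintro y ⟨a, t, ht, h⟩
    exact ⟨-a, t, ht, by rw [map_neg, ← h]; ring⟩

end BaseChange

/-! ### Pure Anderson motives -/

section Motive

variable {Fq : Type u} {Q : Type v} [Field Fq] [Fintype Fq] [Field Q] [Algebra Fq Q]
variable {inf : Place Fq Q} {L : Type w} [Field L] [Algebra Fq L]

/-- An `A_L`-module has dimension `d` over `L`. -/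
def HasLDim (X : Type x) [AddCommGroup X] [Module (AL inf L) X] (d : ℕ) : Prop :=
  letI : Module L X := Module.compHom X
    (Algebra.TensorProduct.includeRight : L →ₐ[Fq] AL inf L).toRingHom
  Module.Finite L X ∧ Module.finrank L X = d

section Generic

variable {M : Type x} [AddCommGroup M] [Module (AL inf L) M]

variable (inf L M) in
/-- The generic stalk of `M`, a vector space over the function field of `C_L`. -/
abbrev Generic : Type (max v w x) := FunctionFieldL Fq Q L ⊗[AL inf L] M

/-- The `σ^*`-semilinear map `y ⊗ m ↦ σ^*(y) ⊗ τ(σ^* m)` induced by `τ` on the generic stalk. -/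
def genericTau (τ : Pullback (frob Fq L (regularAway inf)) M →ₗ[AL inf L] M) :
    Generic inf L M →+ Generic inf L M :=
  TensorProduct.liftAddHom
    { toFun := fun y =>
        { toFun := fun m => frobFunctionField Fq Q L y ⊗ₜ τ (.of _ m)
          map_zero' := by
            rw [Pullback.of_zero, map_zero, TensorProduct.tmul_zero]
          map_add' := fun m m' => by
            rw [Pullback.of_add, map_add, TensorProduct.tmul_add] }
      map_zero' := by
        ext m
        change frobFunctionField Fq Q L 0 ⊗ₜ[AL inf L] τ (.of _ m) = 0
        rw [map_zero, TensorProduct.zero_tmul]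
      map_add' := fun y y' => by
        ext m
        change frobFunctionField Fq Q L (y + y') ⊗ₜ[AL inf L] τ (.of _ m) =
          frobFunctionField Fq Q L y ⊗ₜ τ (.of _ m) + frobFunctionField Fq Q L y' ⊗ₜ τ (.of _ m)
        rw [map_add, TensorProduct.add_tmul] }
    (fun a y m => by
      change frobFunctionField Fq Q L (a • y) ⊗ₜ[AL inf L] τ (.of _ m) =
        frobFunctionField Fq Q L y ⊗ₜ τ (.of _ (a • m))
      rw [Pullback.of_smul, τ.map_smul, frobFunctionField_smul, TensorProduct.smul_tmul])

/-- The purity condition. A locally free sheaf `ℳ` of rank `r` on `C_L` extending `M` amounts to a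
free `𝒪_{C_L,∞}`-lattice `ℳ_∞` of rank `r` in the generic stalk of `M`, i.e. the span of a basis
`b`. The image of `(σ^*)^l ℳ_∞` under `τ^l` is the span of the image of `ℳ_∞` under the `l`-th
iterate of the semilinear map induced by `τ`; it has to be equal to
`ℳ(k · ∞)_∞ = z ^ (-k) ℳ_∞`, where `z` is a uniformizer at `∞`. -/
def IsPureAt (τ : Pullback (frob Fq L (regularAway inf)) M →ₗ[AL inf L] M) (r : ℕ) : Prop :=
  ∃ (b : Module.Basis (Fin r) (FunctionFieldL Fq Q L) (Generic inf L M)) (k l : ℕ) (z : inf.ring),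
    0 < k ∧ 0 < l ∧ IsLocalRing.maximalIdeal inf.ring = Ideal.span {z} ∧
    let lattice : Submodule (stalk inf L) (Generic inf L M) :=
      Submodule.span (stalk inf L) (Set.range b)
    ∀ y : Generic inf L M,
      y ∈ Submodule.span (stalk inf L) ((genericTau τ)^[l] '' (lattice : Set (Generic inf L M))) ↔
        inclLocal inf L (z ⊗ₜ 1) ^ k • y ∈ lattice

end Generic

/-- A pure Anderson motive over `L` of characteristic `c`. -/
structure PureMotive (c : regularAway inf →ₐ[Fq] L) where
  /-- the underlying `A_L`-module -/
  carrier : Type x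
  [addCommGroup : AddCommGroup carrier]
  [module : Module (AL inf L) carrier]
  /-- the rank -/
  rank : ℕ
  /-- the dimension -/
  dim : ℕ
  finite : Module.Finite (AL inf L) carrier
  projective : Module.Projective (AL inf L) carrier
  rankAtStalk_eq : ∀ p : PrimeSpectrum (AL inf L), Module.rankAtStalk carrier p = rank
  /-- the `A_L`-linear map `τ : σ^* M → M` -/
  τ : Pullback (frob Fq L (regularAway inf)) carrier →ₗ[AL inf L] carrier
  τ_injective : Function.Injective τ
  coker_dim : HasLDim (inf := inf) (L := L) (carrier ⧸ LinearMap.range τ) dim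
  coker_annihilated : ∀ j ∈ idealJ inf L c ^ dim, ∀ y : carrier ⧸ LinearMap.range τ, j • y = 0
  pure : IsPureAt τ rank

attribute [instance] PureMotive.addCommGroup PureMotive.module

variable {c : regularAway inf →ₐ[Fq] L}

/-- An `A_L`-linear map is a morphism of pure Anderson motives if `f ∘ τ = τ' ∘ σ^* f`. -/
def IsMorphism (M M' : PureMotive.{u, v, w, x} c) (f : M.carrier →ₗ[AL inf L] M'.carrier) : Prop :=
  f ∘ₗ M.τ = M'.τ ∘ₗ Pullback.map _ f

/-- An isogeny: an injective morphism with torsion cokernel. -/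
structure IsIsogeny (M M' : PureMotive.{u, v, w, x} c) (f : M.carrier →ₗ[AL inf L] M'.carrier) :
    Prop where
  isMorphism : IsMorphism M M' f
  injective : Function.Injective f
  torsion_coker : Module.IsTorsion (AL inf L) (M'.carrier ⧸ LinearMap.range f)

lemma isMorphism_iff {M M' : PureMotive.{u, v, w, x} c} {f : M.carrier →ₗ[AL inf L] M'.carrier} :
    IsMorphism M M' f ↔ ∀ y, f (M.τ y) = M'.τ (Pullback.map _ f y) :=
  LinearMap.ext_iff

/-- `a ⊗ 1 ∈ A_L` acts on a pure Anderson motive by a morphism. -/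
lemma isMorphism_scalar (M : PureMotive.{u, v, w, x} c) (a : regularAway inf) :
    IsMorphism M M (algebraMap (AL inf L) (Module.End (AL inf L) M.carrier) (a ⊗ₜ[Fq] (1 : L))) := by
  rw [isMorphism_iff]
  intro y
  rw [Pullback.map_algebraMap, Module.algebraMap_end_apply, ← M.τ.map_smul]
  simp [frob]

/-- The ring `End(M)` of endomorphisms of a pure Anderson motive. -/
def End (M : PureMotive.{u, v, w, x} c) : Subring (Module.End (AL inf L) M.carrier) where
  carrier := {f | IsMorphism M M f}
  one_mem' := by
    refine isMorphism_iff.2 fun y => ?_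
    rw [Pullback.map_one]; rfl
  mul_mem' {f g} hf hg := by
    refine isMorphism_iff.2 fun y => ?_
    rw [Pullback.map_mul]
    exact (congrArg f (isMorphism_iff.1 hg y)).trans (isMorphism_iff.1 hf _)
  zero_mem' := by
    refine isMorphism_iff.2 fun y => ?_
    rw [Pullback.map_zero]; exact (map_zero M.τ).symm
  add_mem' {f g} hf hg := by
    refine isMorphism_iff.2 fun y => ?_
    rw [Pullback.map_add]
    exact (congrArg₂ (· + ·) (isMorphism_iff.1 hf y) (isMorphism_iff.1 hg y)).trans
      (map_add M.τ _ _).symm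
  neg_mem' {f} hf := by
    refine isMorphism_iff.2 fun y => ?_
    rw [Pullback.map_neg]
    exact (congrArg (- ·) (isMorphism_iff.1 hf y)).trans (map_neg M.τ _).symm

/-- `End(M)` is an `A`-algebra: `a ∈ A` acts as multiplication by `a ⊗ 1`. -/
instance (M : PureMotive.{u, v, w, x} c) : Algebra (regularAway inf) (End M) :=
  RingHom.toAlgebra'
    (((algebraMap (AL inf L) (Module.End (AL inf L) M.carrier)).comp
      (Algebra.TensorProduct.includeLeft : regularAway inf →ₐ[Fq] AL inf L).toRingHom).codRestrict
        (End M) (isMorphism_scalar M))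
    (fun a f => Subtype.ext (Algebra.commutes (A := Module.End (AL inf L) M.carrier)
      (a ⊗ₜ[Fq] (1 : L)) f.1))

/-- The endomorphism `Q`-algebra `E = End(M) ⊗_A Q`. -/
abbrev QEnd (M : PureMotive.{u, v, w, x} c) : Type (max v x) := Q ⊗[regularAway inf] End M

/-- For an isogeny `f : M' → M`, the subset `f · End(M') · f⁻¹` of `E = End(M) ⊗_A Q`. Here
`f⁻¹ = a⁻¹ ⊗ g` for a nonzero `a ∈ A` and a morphism `g : M → M'` with `f ∘ g = a` and `g ∘ f = a`;
so the elements are the `a⁻¹ ⊗ (f ∘ h ∘ g)` for `h ∈ End(M')`, whatever the choice of `(a, g)`. -/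
def conjEnd {M' M : PureMotive.{u, v, w, x} c} (f : M'.carrier →ₗ[AL inf L] M.carrier) :
    Set (QEnd M) :=
  {e | ∃ (a : regularAway inf) (g : M.carrier →ₗ[AL inf L] M'.carrier) (h : End M') (t : End M),
    a ≠ 0 ∧ IsMorphism M M' g ∧ (∀ m, f (g m) = (a ⊗ₜ[Fq] (1 : L) : AL inf L) • m) ∧
    (∀ m, g (f m) = (a ⊗ₜ[Fq] (1 : L) : AL inf L) • m) ∧
    t.1 = f ∘ₗ h.1 ∘ₗ g ∧ e = ((a : Q)⁻¹) ⊗ₜ t}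

end Motive

/-! ### Orders -/

/-- An `A`-order in a `K`-algebra `E`, where `K` is the field of fractions of `A`: a subring of `E`
(with the same unit) which is a finitely generated `A`-module and generates `E` over `K`. -/
structure IsOrder (A : Type u) (K : Type v) {E : Type w} [CommRing A] [Field K] [Ring E]
    [Algebra A E] [Algebra K E] (S : Subalgebra A E) : Prop where
  finite : Module.Finite A S
  span_eq_top : Submodule.span K (S : Set E) = ⊤

end AndersonMotive

end

/-! The order itself cuts out the lattice. If `a` is a common denominator of `S`, then `S = a⁻¹ T`
for a finitely generated `A`-module `T = ⟨t₁, …, tₙ⟩` of endomorphisms of `M`. Let `M'` be the sum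
of the images `tᵢ(M)` (`imageModule`, `imageMotive`). Since `1 ∈ S`, one has `a ∈ T`, hence `a M ⊆
M' ⊆ M`, and the inclusion `f` is an isogeny whose partner `g` is multiplication by `a`. Since `S S
⊆ S`, every `y ∈ T` maps `M'` into `a M'`, so `a⁻¹ y` acts on `M'`; this gives `S ⊆ f End(M') f⁻¹`
(`exists_conjHom_eq`). The right-hand side is again an order: it acts faithfully on a finitely
generated projective module over `A_L`, which is free over `A`, and it lies in the
finite-dimensional space `E` (`finite_of_injective_end`, `IsOrder.of_le_range`). Maximality of `S`
turns the inclusion into an equality.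

It remains to see that `M'` is a pure Anderson motive. Stability under `τ` and annihilation of the
cokernel by `J^d` hold because the `tᵢ` commute with `τ` and with scalars. The rank and the
dimension of the cokernel are compared along the two injections `M' ⊆ M` and `a : M → M'`
(`length_coker_le`). Purity is a condition on the generic stalk, which an isogeny does not change
(`IsPureAt.of_isogeny`). Local freeness is a dévissage along the prime ideals of `A` dividing `a`,
resting on the semisimplicity of `(A/p) ⊗ L` (`projective_of_map_smul_top_le`).

All this uses that `A` is a Dedekind domain with fraction field `Q` and that `A/(a)` is finite over
`Fq`. Since `A` is defined by regularity conditions at places, the crucial point is a function whose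
only pole is `∞` (`exists_mem_regularAway_notMem`); it comes from the finiteness of the first
cohomology of the structure sheaf (`exists_fg_sup_eq_top`). -/

noncomputable section

namespace AndersonMotive

/-! ### Function fields in one variable as finite extensions of `k(t)` -/

section FunctionField

open Polynomial

variable {k : Type u} {Q : Type v} [Field k] [Field Q] [Algebra k Q]

-- The transcendence degree of `Q` is at most one, so `t` is a transcendence basis and `Q` is
-- algebraic over `k(t)`; essential finite type turns this into finiteness. Any function with a pole
-- can therefore serve as a coordinate.
open scoped IntermediateField.algebraAdjoinAdjoin in
lemma IsCurveFunctionField.finiteDimensional_adjoin (hQ : IsCurveFunctionField k Q) {t : Q}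
    (ht : Transcendental k t) : FiniteDimensional (IntermediateField.adjoin k {t}) Q := by
  obtain ⟨s, hs, hfin⟩ := hQ.exists_finite
  have hess : Algebra.EssFiniteType k Q :=
    have : Algebra.EssFiniteType k (IntermediateField.adjoin k {s}) :=
      have : Algebra.FiniteType k (Algebra.adjoin k {s}) :=
        .adjoin_of_finite (Set.finite_singleton s)
      have : Algebra.EssFiniteType (Algebra.adjoin k {s}) (IntermediateField.adjoin k {s}) :=
        .of_isLocalization _ (nonZeroDivisors _)
      .comp _ (Algebra.adjoin k {s}) _
    .comp _ (IntermediateField.adjoin k {s}) _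
  have halg : Algebra.IsAlgebraic (Algebra.adjoin k {s}) Q :=
    Algebra.IsAlgebraic.trans _ (IntermediateField.adjoin k {s}) _
  have htr : Algebra.trdeg k Q ≤ 1 := by
    simpa using Algebra.IsAlgebraic.trdeg_le_cardinalMk k ({s} : Set Q)
  have hb : IsTranscendenceBasis k (fun _ : Unit => t) :=
    AlgebraicIndependent.isTranscendenceBasis_of_lift_trdeg_le_of_finite
      (algebraicIndependent_unique_type_iff.2 ht) (by simpa using htr)
  have := hb.isAlgebraic_field
  rw [Set.range_const] at this
  have : Algebra.EssFiniteType (IntermediateField.adjoin k {t}) Q := .of_comp k _ _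
  exact Algebra.finite_of_essFiniteType_of_isAlgebraic

/-- Up to denominators in `k[t]`, the elements of `Q` are combinations of finitely many. -/
lemma exists_spanning_family {t : Q}
    (h : FiniteDimensional (IntermediateField.adjoin k {t}) Q) :
    ∃ (n : ℕ) (b : Fin n → Q), ∀ y : Q, ∃ (g : k[X]) (f : Fin n → k[X]), aeval t g ≠ 0 ∧
      aeval t g * y = ∑ i, aeval t (f i) * b i := by
  let b := Module.finBasis (IntermediateField.adjoin k {t}) Q
  refine ⟨_, b, fun y => ?_⟩
  have hc : ∀ i, ∃ r s : k[X], aeval t s ≠ 0 ∧ ((b.repr y i : IntermediateField.adjoin k {t}) : Q) =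
      aeval t r / aeval t s := fun i => by
    obtain ⟨r, s, hrs⟩ := (IntermediateField.mem_adjoin_simple_iff k _).1 (b.repr y i).2
    -- The description of `k(t)` by fractions allows a zero denominator; such a fraction is zero by
    -- convention and is rewritten as `0 / 1`.
    by_cases hs : aeval t s = 0
    · exact ⟨0, 1, by simp, by rw [hrs, hs]; simp⟩
    · exact ⟨r, s, hs, hrs⟩
  choose r s hs hrs using hc
  refine ⟨∏ i, s i, fun i => r i * ∏ j ∈ Finset.univ.erase i, s j, ?_, ?_⟩
  · rw [map_prod]; exact Finset.prod_ne_zero_iff.2 fun i _ => hs i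
  · conv_lhs => rw [← b.sum_repr y, Finset.mul_sum]
    refine Finset.sum_congr rfl fun i _ => ?_
    rw [IntermediateField.smul_def, hrs, ← Finset.mul_prod_erase _ _ (Finset.mem_univ i), map_mul,
      map_mul, smul_eq_mul]
    field_simp [hs i]

/-- Over the polynomial ring, `Q` has finite rank. -/
lemma exists_relation {t : Q} {n : ℕ} {b : Fin n → Q}
    (hb : ∀ y : Q, ∃ (g : k[X]) (f : Fin n → k[X]), aeval t g ≠ 0 ∧
      aeval t g * y = ∑ i, aeval t (f i) * b i) {m : ℕ} (hm : n < m) (y : Fin m → Q) :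
    ∃ p : Fin m → k[X], p ≠ 0 ∧ ∑ j, aeval t (p j) * y j = 0 := by
  choose g f hg hgf using fun j => hb (y j)
  -- There are more unknowns than equations, so the matrix of numerators has a kernel vector `c`;
  -- multiplying its entries by the denominators `g j` yields the relation.
  let φ : (Fin m → k[X]) →ₗ[k[X]] (Fin n → k[X]) :=
    (Matrix.of fun i j => f j i).mulVecLin
  have hφ : ¬ Function.Injective φ := fun h => absurd (le_of_fin_injective _ φ h) (by omega)
  rw [← LinearMap.ker_eq_bot, Submodule.eq_bot_iff] at hφ
  push Not at hφ
  obtain ⟨c, hc, hc0⟩ := hφ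
  refine ⟨fun j => c j * g j, fun h => hc0 ?_, ?_⟩
  · funext j
    have := congrFun h j
    simp only [Pi.zero_apply, mul_eq_zero] at this
    refine this.resolve_right fun h0 => hg j ?_
    rw [h0, map_zero]
  · have h1 : ∀ i, ∑ j, aeval t (f j i) * aeval t (c j) = 0 := fun i => by
      have h2 := congrFun (LinearMap.mem_ker.1 hc) i
      have h3 : ∑ j, f j i * c j = 0 := h2
      simpa using congrArg (aeval t) h3
    calc ∑ j, aeval t (c j * g j) * y j = ∑ j, aeval t (c j) * ∑ i, aeval t (f j i) * b i := by
          refine Finset.sum_congr rfl fun j _ => ?_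
          rw [← hgf, map_mul, mul_assoc]
      _ = ∑ i, (∑ j, aeval t (f j i) * aeval t (c j)) * b i := by
          simp only [Finset.mul_sum, Finset.sum_mul]
          rw [Finset.sum_comm]
          refine Finset.sum_congr rfl fun i _ => Finset.sum_congr rfl fun j _ => by ring
      _ = 0 := by simp [h1]

end FunctionField

/-! ### Finite codimension of nonzero principal ideals, and a Dedekind criterion -/

section FunctionField

open Polynomial

variable {k : Type u} {Q : Type v} [Field k] [Field Q] [Algebra k Q]

lemma aeval_mk_coe (B : Subalgebra k Q) {t : Q} (htB : t ∈ B) (p : k[X]) :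
    ((aeval (⟨t, htB⟩ : B) p : B) : Q) = aeval t p :=
  (Polynomial.aeval_algHom_apply B.val _ p).symm

/-- `B` is only known to have rank at most `n` over `k[t]`, not to be finitely generated, so the
dimension is bounded by testing finite independent sets. Lifts of such a set generate a free
`k[t]`-module of rank at most `n`, and reduction modulo `f` leaves the powers of `t` up to `deg f`.
The resulting bound `(deg f + 1) n` is not sharp, but it covers constant `f` as well. -/
lemma finite_quotient_aeval {B : Type v} [CommRing B] [IsDomain B] [Algebra k B] {tB : B}
    (ht : Transcendental k tB) {n : ℕ}
    (hb : ∀ m, n < m → ∀ y : Fin m → B, ∃ p : Fin m → k[X], p ≠ 0 ∧ ∑ j, aeval tB (p j) * y j = 0)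
    (f : k[X]) (hf : f ≠ 0) :
    Module.Finite k (B ⧸ Ideal.span {aeval tB f}) := by
  classical
  let _ : Algebra k[X] B := (aeval tB).toAlgebra
  have hsmul : ∀ (p : k[X]) (y : B), p • y = aeval tB p * y := fun p y => rfl
  have : Module.IsTorsionFree k[X] B := Module.isTorsionFree_iff_smul_eq_zero.2 (by
    intro p y h
    rw [hsmul, mul_eq_zero] at h
    refine h.imp_left fun h0 => ?_
    exact (transcendental_iff_injective.1 ht) (by rw [h0, map_zero]))
  set I := Ideal.span {aeval tB f}
  have key : ∀ (s : Finset (B ⧸ I)), LinearIndependent k (fun i : s => (i : B ⧸ I)) →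
      s.card ≤ (f.natDegree + 1) * n := by
    intro s hs
    choose v hv using fun i : s => Ideal.Quotient.mk_surjective (i : B ⧸ I)
    let N : Submodule k[X] B := Submodule.span k[X] (Set.range v)
    have : Module.Finite k[X] N := Module.Finite.span_of_finite _ (Set.finite_range v)
    have : Module.Free k[X] N := Module.free_of_finite_type_torsion_free'
    let β := Module.finBasis k[X] N
    set r := Module.finrank k[X] N
    have hr : r ≤ n := by
      by_contra! hlt
      obtain ⟨p, hp0, hp⟩ := hb _ hlt (fun j => (β j : B))
      refine hp0 (funext fun j => Fintype.linearIndependent_iff.1 β.linearIndependent p ?_ j)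
      refine Subtype.ext ?_
      rw [Submodule.coe_sum]
      exact hp
    let w : Fin (f.natDegree + 1) × Fin r → B ⧸ I :=
      fun e => Ideal.Quotient.mk I (tB ^ (e.1 : ℕ) * (β e.2 : B))
    have hle : Set.range (fun i : s => (i : B ⧸ I)) ≤ Submodule.span k (Set.range w) := by
      rintro _ ⟨i, rfl⟩
      have hvi : v i ∈ N := Submodule.subset_span ⟨i, rfl⟩
      have h1 : v i = ∑ j, aeval tB (β.repr ⟨v i, hvi⟩ j) * (β j : B) := by
        have := congrArg (Subtype.val) (β.sum_repr ⟨v i, hvi⟩)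
        rw [Submodule.coe_sum] at this
        exact this.symm
      change (i : B ⧸ I) ∈ Submodule.span k (Set.range w)
      rw [← hv i, h1, map_sum]
      refine Submodule.sum_mem _ fun j _ => ?_
      generalize β.repr ⟨v i, hvi⟩ j = p
      have h2 : Ideal.Quotient.mk I (aeval tB p * (β j : B)) =
          Ideal.Quotient.mk I (aeval tB (p % f) * (β j : B)) := by
        rw [Ideal.Quotient.mk_eq_mk_iff_sub_mem, Ideal.mem_span_singleton']
        refine ⟨aeval tB (p / f) * (β j : B), ?_⟩
        have h3 := congrArg (aeval tB) (EuclideanDomain.div_add_mod p f)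
        rw [map_add, map_mul] at h3
        rw [← h3]
        ring
      rw [h2, aeval_eq_sum_range' (n := f.natDegree + 1)
        (Nat.lt_succ_of_le (natDegree_le_natDegree (degree_mod_lt p hf).le)), Finset.sum_mul,
        map_sum]
      refine Submodule.sum_mem _ fun e he => ?_
      rw [smul_mul_assoc]
      refine Submodule.smul_mem _ _ (Submodule.subset_span
        (Set.mem_range_self (f := w) (⟨e, Finset.mem_range.1 he⟩, j)))
    let _ : Fintype (Set.range w) := Set.fintypeRange w
    have h3 := linearIndependent_le_span' _ hs (Set.range w) hle
    have h4 : Fintype.card s ≤ Fintype.card (Set.range w) := by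
      rw [Cardinal.mk_fintype] at h3
      exact_mod_cast h3
    rw [Fintype.card_coe] at h4
    refine h4.trans ((Fintype.card_range_le w).trans ?_)
    simp only [Fintype.card_prod, Fintype.card_fin]
    exact Nat.mul_le_mul_left _ hr
  have : Module.Free k (B ⧸ I) := Module.Free.of_divisionRing k _
  exact Module.rank_lt_aleph0_iff.1 ((rank_le key).trans_lt Cardinal.natCast_lt_aleph0)

/-- A nonzero element of a subalgebra containing a transcendental element has finite
codimension. -/
lemma finite_quotient_span_singleton {t : Q} (ht : Transcendental k t)
    (hfin : FiniteDimensional (IntermediateField.adjoin k {t}) Q)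
    (B : Subalgebra k Q) (htB : t ∈ B) (a : B) (ha : a ≠ 0) :
    Module.Finite k (B ⧸ Ideal.span {a}) := by
  obtain ⟨n, b, hb⟩ := exists_spanning_family hfin
  -- The `n + 1` powers of `a` are dependent over `k[t]`, so `a` is a root of a nonzero polynomial
  -- `P`. Hence the ideal `(a)` contains some nonzero `f(t)`, and `B/(a)` is a quotient of
  -- `B/(f(t))`.
  obtain ⟨p, hp0, hp⟩ := exists_relation hb (Nat.lt_succ_self n) (fun j => (a : Q) ^ (j : ℕ))
  let P : k[X][X] := ∑ j : Fin (n + 1), monomial (j : ℕ) (p j)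
  have hP0 : P ≠ 0 := by
    intro h
    refine hp0 (funext fun j => ?_)
    have h1 := congrArg (fun q => coeff q (j : ℕ)) h
    simpa [P, coeff_monomial, Fin.val_inj] using h1
  have hP : P.eval₂ (aeval (⟨t, htB⟩ : B) : k[X] →ₐ[k] B).toRingHom a = 0 := by
    refine Subtype.ext ?_
    simp only [P, eval₂_finsetSum, eval₂_monomial, AddSubmonoidClass.coe_finsetSum]
    rw [ZeroMemClass.coe_zero, ← hp]
    refine Finset.sum_congr rfl fun j _ => ?_
    simp only [MulMemClass.coe_mul, SubmonoidClass.coe_pow]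
    congr 1
    exact aeval_mk_coe B htB (p j)
  have hne := Ideal.comap_ne_bot_of_root_mem ha (Ideal.mem_span_singleton_self a) hP0 hP
  obtain ⟨f, hf, hf0⟩ := Submodule.exists_mem_ne_zero_of_ne_bot hne
  have hfa : Ideal.span {aeval (⟨t, htB⟩ : B) f} ≤ Ideal.span {a} :=
    (Ideal.span_singleton_le_iff_mem _).2 hf
  have htB' : Transcendental k (⟨t, htB⟩ : B) := by
    rw [transcendental_iff_injective] at ht ⊢
    intro p q hpq
    refine ht ?_
    rw [← aeval_mk_coe B htB, ← aeval_mk_coe B htB, hpq]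
  have := finite_quotient_aeval htB' (n := n) (fun m hm y => by
    obtain ⟨p, hp0, hp⟩ := exists_relation hb hm (fun j => (y j : Q))
    refine ⟨p, hp0, Subtype.ext ?_⟩
    rw [AddSubmonoidClass.coe_finsetSum, ZeroMemClass.coe_zero, ← hp]
    exact Finset.sum_congr rfl fun j _ => congrArg (· * (y j : Q)) (aeval_mk_coe B htB (p j))) f hf0
  exact Module.Finite.of_surjective (Ideal.Quotient.factorₐ k hfa).toLinearMap
    (Ideal.Quotient.factor_surjective hfa)

end FunctionField

/-- An integrally closed domain over a field in which nonzero principal ideals have finite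
codimension is a Dedekind domain. -/
lemma isDedekindDomain_of_finite_quotient (k : Type u) {B : Type v} [Field k] [CommRing B]
    [IsDomain B] [Algebra k B] [IsIntegrallyClosed B]
    (h : ∀ a : B, a ≠ 0 → Module.Finite k (B ⧸ Ideal.span {a})) : IsDedekindDomain B := by
  have hN : IsNoetherianRing B := by
    refine ⟨fun I => ?_⟩
    by_cases hI : I = ⊥
    · rw [hI]; exact Submodule.fg_bot
    obtain ⟨a, ha, ha0⟩ := Submodule.exists_mem_ne_zero_of_ne_bot hI
    have := h a ha0
    have : IsNoetherian k (B ⧸ Ideal.span {a}) := inferInstance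
    have : IsNoetherian B (B ⧸ Ideal.span {a}) := isNoetherian_of_tower k this
    refine Submodule.fg_of_fg_map_of_fg_inf_ker (Ideal.span {a}).mkQ (IsNoetherian.noetherian _) ?_
    rw [Submodule.ker_mkQ, inf_eq_right.2 ((Ideal.span_singleton_le_iff_mem I).2 ha)]
    exact Submodule.fg_span_singleton a
  have hD : Ring.DimensionLEOne B := by
    refine ⟨fun {p} hp0 hp => ?_⟩
    obtain ⟨a, ha, ha0⟩ := Submodule.exists_mem_ne_zero_of_ne_bot hp0
    have := h a ha0
    have hle := (Ideal.span_singleton_le_iff_mem p).2 ha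
    have : Module.Finite k (B ⧸ p) :=
      Module.Finite.of_surjective (Ideal.Quotient.factorₐ k hle).toLinearMap
        (Ideal.Quotient.factor_surjective hle)
    have : Algebra.IsIntegral k (B ⧸ p) := inferInstance
    exact Ideal.Quotient.maximal_of_isField p (isField_of_isIntegral_of_isField' (Field.toIsField k))
  exact { }

/-! ### Places, their centres on Dedekind subrings, and poles -/

section Places

open Polynomial

variable {k : Type u} {Q : Type v} [Field k] [Field Q] [Algebra k Q]

namespace Place

instance isTrivialOn_valuation (P : Place k Q) : P.ring.valuation.IsTrivialOn k where
  eq_one a ha := by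
    refine le_antisymm ((P.ring.valuation_le_one_iff _).2 (P.algebraMap_mem a)) ?_
    have h := (P.ring.valuation_le_one_iff _).2 (P.algebraMap_mem a⁻¹)
    rw [map_inv₀, map_inv₀] at h
    have h0 : P.ring.valuation (algebraMap k Q a) ≠ 0 := by simpa using ha
    exact (inv_le_one₀ (zero_lt_iff.2 h0)).1 h

lemma one_lt_valuation_iff (P : Place k Q) (y : Q) : 1 < P.ring.valuation y ↔ y ∉ P.ring := by
  rw [← not_le, P.ring.valuation_le_one_iff]

lemma ext_ring {P P' : Place k Q} (h : P.ring = P'.ring) : P = P' := by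
  cases P; cases P'; cases h; rfl

lemma mem_of_isIntegral (P : Place k Q) (R : Subalgebra k Q) (hR : ∀ y ∈ R, y ∈ P.ring) {y : Q}
    (hy : IsIntegral R y) : y ∈ P.ring := by
  let ι : R →+* P.ring := R.val.toRingHom.codRestrict P.ring.toSubring fun y => hR y y.2
  let _ : Algebra R P.ring := ι.toAlgebra
  have : IsScalarTower R P.ring Q := IsScalarTower.of_algebraMap_eq fun _ => rfl
  obtain ⟨z, hz⟩ := IsIntegrallyClosed.isIntegral_iff.1 (hy.tower_top (A := P.ring))
  exact hz ▸ z.2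

lemma adjoin_le (P : Place k Q) {x : Q} (hx : x ∈ P.ring) : ∀ y ∈ Algebra.adjoin k {x}, y ∈ P.ring := by
  intro y hy
  induction hy using Algebra.adjoin_induction with
  | mem y hy => rw [Set.mem_singleton_iff.1 hy]; exact hx
  | algebraMap r => exact P.algebraMap_mem r
  | add _ _ _ _ h h' => exact add_mem h h'
  | mul _ _ _ _ h h' => exact mul_mem h h'

lemma aeval_mem (P : Place k Q) {x : Q} (hx : x ∈ P.ring) (p : k[X]) : aeval x p ∈ P.ring :=
  P.adjoin_le hx _ (aeval_mem_adjoin_singleton k x)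

lemma transcendental_of_notMem (P : Place k Q) {y : Q} (hy : y ∉ P.ring) : Transcendental k y := by
  intro h
  refine hy (P.mem_of_isIntegral ⊥ ?_ (h.isIntegral.tower_top))
  rintro _ ⟨a, rfl⟩
  exact P.algebraMap_mem a

/-- A rational function in `x` which is regular at infinity is regular at the poles of `x`. -/
lemma aeval_div_aeval_mem (P : Place k Q) {x : Q} (hx : x ∉ P.ring) {r G : k[X]} (hG : G ≠ 0)
    (h : r.natDegree ≤ G.natDegree) : aeval x r / aeval x G ∈ P.ring := by
  have h1 := (P.one_lt_valuation_iff x).2 hx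
  by_cases hr : r = 0
  · simp [hr]
  rw [← P.ring.valuation_le_one_iff, map_div₀,
    valuation_aeval_eq_valuation_X_pow_natDegree_of_one_lt_valuation_X x h1 hr,
    valuation_aeval_eq_valuation_X_pow_natDegree_of_one_lt_valuation_X x h1 hG]
  exact div_le_one_of_le₀ (pow_le_pow_right₀ h1.le h) zero_le

lemma aeval_notMem (P : Place k Q) {x : Q} (hx : x ∉ P.ring) {p : k[X]} (hp : p.natDegree ≠ 0) :
    aeval x p ∉ P.ring := by
  have h1 := (P.one_lt_valuation_iff x).2 hx
  rw [← P.one_lt_valuation_iff,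
    valuation_aeval_eq_valuation_X_pow_natDegree_of_one_lt_valuation_X x h1 (by
      rintro rfl; exact hp natDegree_zero)]
  exact one_lt_pow₀ h1 hp

end Place

/-- The functions which are regular at all places at which `x` is regular. -/
def regularWhere (k : Type u) {Q : Type v} [Field k] [Field Q] [Algebra k Q] (x : Q) :
    Subalgebra k Q where
  carrier := {y | ∀ P : Place k Q, x ∈ P.ring → y ∈ P.ring}
  mul_mem' ha hb P hP := mul_mem (ha P hP) (hb P hP)
  add_mem' ha hb P hP := add_mem (ha P hP) (hb P hP)
  algebraMap_mem' a P _ := P.algebraMap_mem a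

lemma self_mem_regularWhere (x : Q) : x ∈ regularWhere k x := fun _ h => h

lemma mem_regularWhere_of_isIntegral {x y : Q} (h : IsIntegral (Algebra.adjoin k {x}) y) :
    y ∈ regularWhere k x :=
  fun P hP => P.mem_of_isIntegral _ (P.adjoin_le hP) h

-- `Q` is algebraic over `k[x]`, so a nonzero multiple of `y` by a polynomial in `x` is integral
-- over `k[x]`, and valuation rings are integrally closed.
open scoped IntermediateField.algebraAdjoinAdjoin in
lemma exists_mul_mem_regularWhere {x : Q}
    (hfin : FiniteDimensional (IntermediateField.adjoin k {x}) Q) (y : Q) :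
    ∃ p : k[X], aeval x p ≠ 0 ∧ aeval x p * y ∈ regularWhere k x := by
  have : Algebra.IsAlgebraic (Algebra.adjoin k {x}) Q :=
    Algebra.IsAlgebraic.trans _ (IntermediateField.adjoin k {x}) _
  obtain ⟨a, ha, hay⟩ := (Algebra.IsAlgebraic.isAlgebraic (R := Algebra.adjoin k {x})
    y).exists_integral_multiple
  obtain ⟨a, ha'⟩ := a
  rw [Algebra.adjoin_singleton_eq_range_aeval] at ha'
  obtain ⟨p, rfl⟩ := ha'
  exact ⟨p, fun h => ha (Subtype.ext h), mem_regularWhere_of_isIntegral hay⟩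

instance isIntegrallyClosed_regularWhere (x : Q) [IsFractionRing (regularWhere k x) Q] :
    IsIntegrallyClosed (regularWhere k x) := by
  refine (isIntegrallyClosed_iff Q).2 fun {y} hy => ⟨⟨y, fun P hP => ?_⟩, rfl⟩
  exact P.mem_of_isIntegral (regularWhere k x) (fun z hz => hz P hP) hy

lemma isFractionRing_regularWhere {x : Q}
    (hfin : FiniteDimensional (IntermediateField.adjoin k {x}) Q) :
    IsFractionRing (regularWhere k x) Q := by
  refine IsFractionRing.of_field _ _ fun y => ?_
  obtain ⟨p, hp, hpy⟩ := exists_mul_mem_regularWhere hfin y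
  refine ⟨⟨_, hpy⟩, ⟨aeval x p, fun P hP => P.aeval_mem hP p⟩, ?_⟩
  exact (mul_div_cancel_left₀ y hp).symm

lemma isDedekindDomain_regularWhere {x : Q} (hx : Transcendental k x)
    (hfin : FiniteDimensional (IntermediateField.adjoin k {x}) Q) :
    IsDedekindDomain (regularWhere k x) :=
  have := isFractionRing_regularWhere hfin
  isDedekindDomain_of_finite_quotient k fun a ha =>
    finite_quotient_span_singleton hx hfin _ (self_mem_regularWhere x) a ha

/-- The centre of a place on a subalgebra of its valuation ring. -/
def Place.center (P : Place k Q) (B : Subalgebra k Q) (h : ∀ y ∈ B, y ∈ P.ring) : Ideal B :=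
  (IsLocalRing.maximalIdeal P.ring).comap
    (B.val.toRingHom.codRestrict P.ring.toSubring fun y => h y y.2 : B →+* P.ring)

lemma Place.mem_center_iff (P : Place k Q) {B : Subalgebra k Q} (h : ∀ y ∈ B, y ∈ P.ring) (b : B) :
    b ∈ P.center B h ↔ P.ring.valuation (b : Q) < 1 :=
  P.ring.valuation_lt_one_iff ⟨b, h b b.2⟩

lemma Place.inv_mem_of_notMem_center (P : Place k Q) {B : Subalgebra k Q}
    (h : ∀ y ∈ B, y ∈ P.ring) {b : B} (hb : b ∉ P.center B h) : (b : Q)⁻¹ ∈ P.ring := by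
  rw [P.mem_center_iff, not_lt] at hb
  rw [← P.ring.valuation_le_one_iff, map_inv₀]
  exact inv_le_one_of_one_le₀ hb

instance Place.isPrime_center (P : Place k Q) (B : Subalgebra k Q) (h : ∀ y ∈ B, y ∈ P.ring) :
    (P.center B h).IsPrime :=
  Ideal.comap_isPrime _ _

/-- With zero centre every nonzero element of `B` would be a unit of the valuation ring, which would
then be all of `Q`. -/
lemma Place.center_ne_bot (P : Place k Q) (B : Subalgebra k Q) [IsFractionRing B Q]
    (h : ∀ y ∈ B, y ∈ P.ring) : P.center B h ≠ ⊥ := by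
  intro h0
  refine P.ne_top (eq_top_iff.2 fun y _ => ?_)
  obtain ⟨a, b, hb, rfl⟩ := IsFractionRing.div_surjective B y
  rw [div_eq_mul_inv]
  refine mul_mem (h _ a.2) (P.inv_mem_of_notMem_center h (b := b) ?_)
  rw [h0, Ideal.mem_bot]
  exact nonZeroDivisors.ne_zero hb

/-- A place is determined by its centre on a Dedekind domain. -/
lemma Place.le_of_center_eq (P P' : Place k Q) (B : Subalgebra k Q) [IsFractionRing B Q]
    [IsDedekindDomain B] (h : ∀ y ∈ B, y ∈ P.ring) (h' : ∀ y ∈ B, y ∈ P'.ring)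
    (hc : P.center B h = P'.center B h') : P.ring ≤ P'.ring := by
  intro y hy
  by_cases hy0 : y = 0
  · exact hy0 ▸ zero_mem _
  set p := P.center B h with hp
  let Bp := Localization.subalgebra.ofField Q p.primeCompl p.primeCompl_le_nonZeroDivisors
  have : IsLocalization.AtPrime Bp p := Localization.subalgebra.isLocalization_ofField _ _ _
  have : IsDiscreteValuationRing Bp :=
    IsLocalization.AtPrime.isDiscreteValuationRing_of_dedekind_domain B (P.center_ne_bot B h) Bp
  have hmem : ∀ z : Q, IsLocalization.IsInteger Bp z →
      ∃ b s : B, s ∉ p ∧ z = (b : Q) * (s : Q)⁻¹ := by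
    rintro _ ⟨⟨z, b, s, hs, hz⟩, rfl⟩
    exact ⟨b, s, hs, hz⟩
  -- The localization of `B` at the centre is a discrete valuation ring, so it contains `y` or
  -- `y⁻¹`. In the second case the numerator of `y⁻¹` lies off the centre, since otherwise `y` would
  -- have a pole at `P`. Either way `y` is a fraction with denominator off the common centre.
  rcases ValuationRing.isInteger_or_isInteger Bp y with h1 | h1
  · obtain ⟨b, s, hs, rfl⟩ := hmem _ h1
    exact mul_mem (h' _ b.2) (P'.inv_mem_of_notMem_center h' (hc ▸ hs))
  · obtain ⟨b, s, hs, hbs⟩ := hmem _ h1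
    by_cases hb : b ∈ p
    · exfalso
      have hb' := (P.mem_center_iff h b).1 hb
      have hs' := (P.ring.valuation_le_one_iff _).2 (P.inv_mem_of_notMem_center h hs)
      have h2 : P.ring.valuation y⁻¹ < 1 := by
        rw [hbs, map_mul]
        exact mul_lt_one_of_nonneg_of_lt_one_left zero_le hb' hs'
      have h3 := (P.ring.valuation_le_one_iff _).2 hy
      have h5 : P.ring.valuation y * P.ring.valuation y⁻¹ = 1 := by
        rw [← map_mul, mul_inv_cancel₀ hy0, map_one]
      exact absurd h5 (mul_lt_one_of_nonneg_of_lt_one_right h3 zero_le h2).ne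
    · rw [← inv_inv y, hbs, mul_inv, inv_inv]
      exact mul_mem (P'.inv_mem_of_notMem_center h' (hc ▸ hb)) (h' _ s.2)

/-- There is a function whose only pole outside of the poles of `x` is a given place. -/
lemma exists_pole_relative {x : Q} (hx : Transcendental k x)
    (hfin : FiniteDimensional (IntermediateField.adjoin k {x}) Q) (P : Place k Q)
    (hP : x ∈ P.ring) :
    ∃ y ∉ P.ring, ∀ P' : Place k Q, P' ≠ P → x ∈ P'.ring → y ∈ P'.ring := by
  have := isFractionRing_regularWhere hfin
  have := isDedekindDomain_regularWhere hx hfin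
  set B := regularWhere k x
  have hB : ∀ P' : Place k Q, x ∈ P'.ring → ∀ y ∈ B, y ∈ P'.ring := fun P' h y hy => hy P' h
  have hbot := P.center_ne_bot B (hB P hP)
  -- The function is any `y ∈ p⁻¹ ∖ B`, where `p` is the centre of `P`. At another place some `r ∈
  -- p` is a unit and `r y ∈ B`, so `y` is regular there; were it regular at `P` too, it would lie
  -- in `B`.
  obtain ⟨y, hy, hy1⟩ := FractionalIdeal.exists_notMem_one_of_ne_bot (K := Q) hbot
    (P.isPrime_center B (hB P hP)).ne_top
  rw [FractionalIdeal.mem_inv_iff (by simpa using hbot)] at hy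
  have key : ∀ P' : Place k Q, P' ≠ P → x ∈ P'.ring → y ∈ P'.ring := by
    intro P' hne hP'
    by_cases hle : P.center B (hB P hP) ≤ P'.center B (hB P' hP')
    · have hmax := (P.isPrime_center B (hB P hP)).isMaximal hbot
      have heq := hmax.eq_of_le (P'.isPrime_center B (hB P' hP')).ne_top hle
      exact absurd (Place.ext_ring (le_antisymm (P'.le_of_center_eq P B _ _ heq.symm)
        (P.le_of_center_eq P' B _ _ heq))) hne
    · obtain ⟨r, hr, hr'⟩ := SetLike.not_le_iff_exists.1 hle
      obtain ⟨z, hz⟩ := (FractionalIdeal.mem_one_iff _).1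
        (hy (algebraMap B Q r) (FractionalIdeal.mem_coeIdeal_of_mem _ hr))
      have hr0 : (r : Q) ≠ 0 := by
        intro h0
        exact hr' ((Subtype.ext h0 : r = 0) ▸ zero_mem _)
      have : y = (z : Q) * (r : Q)⁻¹ := by
        rw [eq_mul_inv_iff_mul_eq₀ hr0]; exact hz.symm
      rw [this]
      exact mul_mem (hB P' hP' _ z.2) (P'.inv_mem_of_notMem_center _ hr')
  refine ⟨y, fun hyP => hy1 ((FractionalIdeal.mem_one_iff _).2 ⟨⟨y, fun P' hP' => ?_⟩, rfl⟩), key⟩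
  by_cases h : P' = P
  · exact h ▸ hyP
  · exact key P' h hP'

end Places

/-! ### Finiteness of cohomology and a function with a single prescribed pole -/

section RiemannInequality

open Polynomial

variable {k : Type u} {Q : Type v} [Field k] [Field Q] [Algebra k Q]

/-- The functions which are regular at the poles of `x`. -/
def regularAtPoles (k : Type u) {Q : Type v} [Field k] [Field Q] [Algebra k Q] (x : Q) :
    Subalgebra k Q where
  carrier := {y | ∀ P : Place k Q, x ∉ P.ring → y ∈ P.ring}
  mul_mem' ha hb P hP := mul_mem (ha P hP) (hb P hP)
  add_mem' ha hb P hP := add_mem (ha P hP) (hb P hP)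
  algebraMap_mem' a P _ := P.algebraMap_mem a

/-- For `d = deg p` one has `p(x⁻¹) = x⁻ᵈ p*(x)` with `p*` the reversed polynomial. If `p(x⁻¹) y` is
regular where `x⁻¹` is, then dividing by `p*(x)` does no harm at the poles of `x`, where the inverse
of a nonzero polynomial in `x` is regular. -/
lemma exists_pow_mul_mem_regularAtPoles {x : Q} (hx : x ≠ 0)
    (hfin : FiniteDimensional (IntermediateField.adjoin k {x⁻¹}) Q) (y : Q) :
    ∃ d : ℕ, x⁻¹ ^ d * y ∈ regularAtPoles k x := by
  obtain ⟨p, hp, hpy⟩ := exists_mul_mem_regularWhere hfin y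
  refine ⟨p.natDegree, fun P hP => ?_⟩
  have h1 : aeval x⁻¹ p * y ∈ P.ring := hpy P ((P.ring.mem_or_inv_mem x).resolve_left hP)
  let _ : Invertible x⁻¹ := invertibleOfNonzero (inv_ne_zero hx)
  have h2 : aeval x p.reverse * x⁻¹ ^ p.natDegree = aeval x⁻¹ p := by
    have := eval₂_reverse_mul_pow (algebraMap k Q) x⁻¹ p
    rwa [invOf_eq_inv, inv_inv] at this
  have h3 : aeval x p.reverse ≠ 0 := fun h => hp (by rw [← h2, h, zero_mul])
  have h4 : p.reverse ≠ 0 := by rintro h; rw [h, map_zero] at h3; exact h3 rfl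
  have h5 := P.aeval_div_aeval_mem hP (r := (1 : k[X])) h4 (by simp)
  have : x⁻¹ ^ p.natDegree * y = aeval x (1 : k[X]) / aeval x p.reverse * (aeval x⁻¹ p * y) := by
    rw [← h2, map_one]
    field_simp
  rw [this]
  exact mul_mem h5 h1

/-- The splitting used in `exists_fg_of_line`, with `a = xᵈ`, `c = x⁻ᵈ` and `b = G(x)`. -/
lemma div_mul_eq_of_mul_eq {F : Type*} [Field F] {a b c q q₀ q₁ r : F} {f : F} (hb : b ≠ 0)
    (hac : a * c = 1) (h : a * f = b * q + r) (hq : q₀ + a * q₁ = q) (z : F) :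
    f / b * z = q₁ * z + r / b * (c * z) + q₀ * (c * z) := by
  have h1 : f = c * (b * q + r) := by rw [← h, ← mul_assoc, mul_comm c, hac, one_mul]
  rw [h1, ← hq]
  field_simp
  linear_combination (q₁ * b * z) * hac

/-- A rational function of `x` is a polynomial, regular where `x` is, plus a proper fraction,
regular at the poles of `x`. A multiple `z` of `w` is regular where `x` is, but at the poles of `x`
only `x⁻ᵈ z` is. This mismatch leaves the span of the finitely many `xⁱ x⁻ᵈ z` with `i ≤ d`, which
is the space `V`. -/
lemma exists_fg_of_line {x : Q} (hx : Transcendental k x)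
    (hfin : FiniteDimensional (IntermediateField.adjoin k {x}) Q)
    (hfin' : FiniteDimensional (IntermediateField.adjoin k {x⁻¹}) Q) (w : Q) :
    ∃ V : Submodule k Q, V.FG ∧ ∀ f g : k[X], aeval x g ≠ 0 → aeval x f / aeval x g * w ∈
      (regularWhere k x).toSubmodule ⊔ (regularAtPoles k x).toSubmodule ⊔ V := by
  have hx0 : x ≠ 0 := by
    rintro rfl; exact hx (isAlgebraic_zero)
  obtain ⟨p, hp, hpw⟩ := exists_mul_mem_regularWhere hfin w
  obtain ⟨d, hd⟩ := exists_pow_mul_mem_regularAtPoles hx0 hfin' (aeval x p * w)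
  obtain ⟨z, hz⟩ : ∃ z, z = aeval x p * w := ⟨_, rfl⟩
  rw [← hz] at hpw hd
  let e : Fin (d + 1) → Q := fun i => x ^ (i : ℕ) * (x⁻¹ ^ d * z)
  refine ⟨Submodule.span k (Set.range e), Submodule.fg_span (Set.finite_range e), fun f g hg => ?_⟩
  obtain ⟨G, hGgp⟩ : ∃ G : k[X], aeval x G = aeval x g * aeval x p := ⟨_, map_mul _ _ _⟩
  have hG : aeval x G ≠ 0 := hGgp ▸ mul_ne_zero hg hp
  have hG0 : G ≠ 0 := by rintro rfl; exact hG (map_zero _)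
  obtain ⟨q, r, hqr, hr⟩ : ∃ q r : k[X], X ^ d * f = G * q + r ∧ r.natDegree ≤ G.natDegree :=
    ⟨X ^ d * f / G, X ^ d * f % G, (EuclideanDomain.div_add_mod (X ^ d * f) G).symm,
      natDegree_le_natDegree (degree_mod_lt (X ^ d * f) hG0).le⟩
  have hqr' := congrArg (aeval x) hqr
  have hq := congrArg (aeval x) (modByMonic_add_div q (X ^ d : k[X]))
  simp only [map_mul, map_add, map_pow, aeval_X] at hqr' hq
  have hxd : x ^ d * x⁻¹ ^ d = 1 := by rw [← mul_pow, mul_inv_cancel₀ hx0, one_pow]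
  have hdeg : (q %ₘ X ^ d).natDegree < d + 1 := by
    refine Nat.lt_succ_of_le ((natDegree_le_natDegree (degree_modByMonic_lt q
      (monic_X_pow d)).le).trans ?_)
    simp
  have hsplit : aeval x f / aeval x g * w = aeval x (q /ₘ X ^ d) * z +
      aeval x r / aeval x G * (x⁻¹ ^ d * z) + aeval x (q %ₘ X ^ d) * (x⁻¹ ^ d * z) := by
    have h2 : aeval x f / aeval x g * w = aeval x f / aeval x G * z := by
      rw [hGgp, hz, div_mul_eq_mul_div, div_mul_eq_mul_div, mul_comm (aeval x p) w, ← mul_assoc,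
        mul_div_mul_right _ _ hp]
    rw [h2]
    exact div_mul_eq_of_mul_eq hG hxd hqr' hq z
  rw [hsplit]
  refine add_mem (add_mem ?_ ?_) ?_
  · refine Submodule.mem_sup_left (Submodule.mem_sup_left ?_)
    exact (regularWhere k x).mul_mem (fun P hP => P.aeval_mem hP _) hpw
  · refine Submodule.mem_sup_left (Submodule.mem_sup_right ?_)
    exact (regularAtPoles k x).mul_mem (fun P hP => P.aeval_div_aeval_mem hP hG0 hr) hd
  · refine Submodule.mem_sup_right ?_
    rw [aeval_eq_sum_range' hdeg, Finset.sum_mul]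
    refine sum_mem fun i hi => ?_
    rw [smul_mul_assoc]
    exact Submodule.smul_mem _ _ (Submodule.subset_span
      (Set.mem_range_self (f := e) ⟨i, Finset.mem_range.1 hi⟩))

/-- The finiteness of the cohomology of the structure sheaf. -/
lemma exists_fg_sup_eq_top {x : Q} (hx : Transcendental k x)
    (hfin : FiniteDimensional (IntermediateField.adjoin k {x}) Q)
    (hfin' : FiniteDimensional (IntermediateField.adjoin k {x⁻¹}) Q) :
    ∃ V : Submodule k Q, V.FG ∧
      (regularWhere k x).toSubmodule ⊔ (regularAtPoles k x).toSubmodule ⊔ V = ⊤ := by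
  obtain ⟨n, b, hb⟩ := exists_spanning_family hfin
  choose V hV hVb using fun i => exists_fg_of_line hx hfin hfin' (b i)
  refine ⟨⨆ i, V i, Submodule.fg_iSup _ hV, eq_top_iff.2 fun y _ => ?_⟩
  obtain ⟨g, f, hg, hgy⟩ := hb y
  have : y = ∑ i, aeval x (f i) / aeval x g * b i := by
    rw [← mul_right_inj' hg, hgy, Finset.mul_sum]
    refine Finset.sum_congr rfl fun i _ => ?_
    field_simp
  rw [this]
  exact sum_mem fun i _ => sup_le_sup_left (le_iSup V i) _ (hVb i _ _ hg)

/-- There is a function with a pole at a given place and no other poles. -/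
lemma exists_mem_regularAway_notMem (hQ : IsCurveFunctionField k Q) (inf : Place k Q) :
    ∃ t ∈ regularAway inf, t ∉ inf.ring := by
  obtain ⟨z, hz⟩ : ∃ z, z ∉ inf.ring := by
    by_contra! h
    exact inf.ne_top (eq_top_iff.2 fun y _ => h y)
  have hztr := inf.transcendental_of_notMem hz
  have hxtr : Transcendental k z⁻¹ := fun h => hztr (by simpa using h.inv)
  have hxmem := (inf.ring.mem_or_inv_mem z).resolve_left hz
  set x := z⁻¹ with hxz
  have hfin := hQ.finiteDimensional_adjoin hxtr
  have hfin' : FiniteDimensional (IntermediateField.adjoin k {x⁻¹}) Q := by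
    rw [hxz, inv_inv]; exact hQ.finiteDimensional_adjoin hztr
  obtain ⟨y, hy, hyP⟩ := exists_pole_relative hxtr hfin inf hxmem
  obtain ⟨V, hV, hVtop⟩ := exists_fg_sup_eq_top hxtr hfin hfin'
  set W := (regularWhere k x).toSubmodule ⊔ (regularAtPoles k x).toSubmodule
  have hfinW : Module.Finite k (Q ⧸ W) := by
    have h1 : V.map W.mkQ = ⊤ := (Submodule.map_mkQ_eq_top W V).2 hVtop
    exact ⟨h1 ▸ hV.map _⟩
  -- By finiteness of `Q/W`, some `y p(y)` with `p ≠ 0` splits as `a + t`, with `a` regular where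
  -- `x` is and `t` regular at the poles of `x`. The factor `X` makes the degree positive, so `y
  -- p(y)` has a pole at `inf`; as `a` has none there, `t` does. Elsewhere `t` is regular, either as
  -- `y p(y) - a` or by its choice.
  let φ : k[X] →ₗ[k] Q ⧸ W := W.mkQ ∘ₗ (aeval y : k[X] →ₐ[k] Q).toLinearMap ∘ₗ
    LinearMap.mulLeft k (X : k[X])
  have hφ : ¬ Function.Injective φ := fun h =>
    Polynomial.not_finite (R := k) (Module.Finite.of_injective φ h)
  rw [← LinearMap.ker_eq_bot, Submodule.eq_bot_iff] at hφ
  push Not at hφ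
  obtain ⟨p, hp, hp0⟩ := hφ
  have hp' : aeval y (X * p) ∈ W := (Submodule.Quotient.mk_eq_zero W).1 hp
  obtain ⟨a, ha, t, ht, hat⟩ := Submodule.mem_sup.1 hp'
  refine ⟨t, fun P hP => ?_, fun htinf => ?_⟩
  · by_cases hxP : x ∈ P.ring
    · have h1 := P.aeval_mem (hyP P hP hxP) (X * p)
      rw [← hat] at h1
      have h2 := sub_mem h1 (ha P hxP)
      rwa [add_sub_cancel_left] at h2
    · exact ht P hxP
  · refine inf.aeval_notMem hy (p := X * p) ?_ (hat ▸ add_mem (ha inf hxmem) htinf)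
    rw [natDegree_X_mul hp0]
    exact Nat.succ_ne_zero _

end RiemannInequality

/-! ### The coordinate ring `A` is a Dedekind domain with fraction field `Q` -/

section CoordinateRing

variable {k : Type u} {Q : Type v} [Field k] [Field Q] [Algebra k Q]

/-- As `inf` is the only pole of `t`, both rings impose conditions at the same places. What is known
about integral closures of `k[t]` thereby passes to `A`. -/
lemma regularAway_eq_regularWhere {inf : Place k Q} {t : Q} (ht : t ∈ regularAway inf)
    (ht' : t ∉ inf.ring) : regularAway inf = regularWhere k t := by
  ext y
  refine ⟨fun hy P hP => hy P ?_, fun hy P hP => hy P (ht P hP)⟩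
  rintro rfl
  exact ht' hP

variable (hQ : IsCurveFunctionField k Q) (inf : Place k Q)
include hQ

lemma isFractionRing_regularAway : IsFractionRing (regularAway inf) Q := by
  obtain ⟨t, ht, ht'⟩ := exists_mem_regularAway_notMem hQ inf
  rw [regularAway_eq_regularWhere ht ht']
  exact isFractionRing_regularWhere
    (hQ.finiteDimensional_adjoin (inf.transcendental_of_notMem ht'))

lemma isDedekindDomain_regularAway : IsDedekindDomain (regularAway inf) := by
  obtain ⟨t, ht, ht'⟩ := exists_mem_regularAway_notMem hQ inf
  have htr := inf.transcendental_of_notMem ht'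
  rw [regularAway_eq_regularWhere ht ht']
  exact isDedekindDomain_regularWhere htr (hQ.finiteDimensional_adjoin htr)

lemma finite_quotient_regularAway (a : regularAway inf) (ha : a ≠ 0) :
    Module.Finite k (regularAway inf ⧸ Ideal.span {a}) := by
  obtain ⟨t, ht, ht'⟩ := exists_mem_regularAway_notMem hQ inf
  have htr := inf.transcendental_of_notMem ht'
  exact finite_quotient_span_singleton htr (hQ.finiteDimensional_adjoin htr) _ ht a ha

end CoordinateRing

/-! ### Projectivity of lattices over `A ⊗ L` -/

section Projective

/-- A submodule `N` of a projective module `P` with `I P ⊆ N` is projective if `I P` is projective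
and `P / I P` is semisimple. -/
lemma projective_of_smul_top_le {R : Type u} [CommRing R] {P : Type v} [AddCommGroup P] [Module R P]
    [Module.Projective R P] (I : Ideal R) (hI : Module.Projective R (I • ⊤ : Submodule R P))
    (hss : IsSemisimpleModule R (P ⧸ (I • ⊤ : Submodule R P))) (N : Submodule R P)
    (hN : I • ⊤ ≤ N) : Module.Projective R N := by
  set K : Submodule R P := I • ⊤
  -- A complement in the semisimple quotient lifts to `C` with `N + C = P` and `N ∩ C ⊆ K`. A
  -- section `s` of `N × C → P` exists as `P` is projective. For `y ∈ N` the difference of `y` and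
  -- the first component of `s y` lies in `N ∩ C ⊆ K`, so `N` is a retract of `K × P`.
  obtain ⟨C', hC'⟩ := exists_isCompl (N.map K.mkQ)
  set C := C'.comap K.mkQ
  have hNC : N ⊔ C = ⊤ := by
    have h1 := congrArg (Submodule.comap K.mkQ) hC'.sup_eq_top
    rw [eq_top_iff]
    intro y _
    obtain ⟨a, ha, b, hb, hab⟩ := Submodule.mem_sup.1
      (show K.mkQ y ∈ N.map K.mkQ ⊔ C' by rw [hC'.sup_eq_top]; trivial)
    obtain ⟨n, hn, rfl⟩ := ha
    refine Submodule.mem_sup.2 ⟨n, hn, y - n, ?_, add_sub_cancel n y⟩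
    change K.mkQ (y - n) ∈ C'
    rw [map_sub, ← hab, add_sub_cancel_left]
    exact hb
  have hNC' : ∀ y ∈ N, y ∈ C → y ∈ K := fun y hy hy' => by
    have h1 : K.mkQ y ∈ N.map K.mkQ ⊓ C' := ⟨Submodule.mem_map_of_mem hy, hy'⟩
    rw [hC'.inf_eq_bot, Submodule.mem_bot] at h1
    exact (Submodule.Quotient.mk_eq_zero K).1 h1
  let σ : (N × C) →ₗ[R] P := N.subtype.coprod C.subtype
  have hσ : Function.Surjective σ := fun y => by
    obtain ⟨a, ha, b, hb, hab⟩ := Submodule.mem_sup.1 (hNC ▸ Submodule.mem_top : y ∈ N ⊔ C)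
    exact ⟨(⟨a, ha⟩, ⟨b, hb⟩), hab⟩
  obtain ⟨s, hs⟩ := Module.projective_lifting_property σ LinearMap.id hσ
  have hs' : ∀ y, ((s y).1 : P) + (s y).2 = y := fun y => LinearMap.congr_fun hs y
  have hmem : ∀ y : N, (y : P) - (s y).1 ∈ K := fun y =>
    hNC' _ (sub_mem y.2 (s y).1.2) (by
      rw [sub_eq_of_eq_add' (hs' y).symm]; exact (s y).2.2)
  let i : N →ₗ[R] K × P :=
    (LinearMap.codRestrict K
      (N.subtype - N.subtype ∘ₗ LinearMap.fst R N C ∘ₗ s ∘ₗ N.subtype) hmem).prod N.subtype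
  let j : K × P →ₗ[R] N :=
    (Submodule.inclusion hN).coprod (LinearMap.fst R N C ∘ₗ s)
  refine Module.Projective.of_split i j (LinearMap.ext fun y => Subtype.ext ?_)
  exact sub_add_cancel (y : P) _

lemma isSemisimpleModule_quotient_smul_top {R : Type u} [CommRing R] (P : Type v) [AddCommGroup P]
    [Module R P] (I : Ideal R) [IsSemisimpleRing (R ⧸ I)] :
    IsSemisimpleModule R (P ⧸ (I • ⊤ : Submodule R P)) := by
  have h : Module.IsTorsionBySet R (P ⧸ (I • ⊤ : Submodule R P)) I := by
    intro y a
    obtain ⟨y, rfl⟩ := Submodule.mkQ_surjective _ y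
    exact (Submodule.Quotient.mk_eq_zero _).2 (Submodule.smul_mem_smul a.2 trivial)
  let _ := h.module
  exact h.isSemisimpleModule_iff.1 inferInstance

/-- If `p` is a projective ideal of `A` and `P` a projective module over a flat `A`-algebra `R`,
then `p P` is projective over `R`. -/
lemma projective_map_smul_top {A : Type u} {R : Type v} [CommRing A] [CommRing R] [Algebra A R]
    [Module.Flat A R] (P : Type w) [AddCommGroup P] [Module R P] [Module.Projective R P]
    (p : Ideal A) [Module.Projective A p] :
    Module.Projective R (p.map (algebraMap A R) • ⊤ : Submodule R P) := by
  let _ : Module A P := Module.compHom P (algebraMap A R)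
  have : IsScalarTower A R P := ⟨fun a r y => by
    rw [Algebra.smul_def, mul_smul]; rfl⟩
  have : Module.Flat A P := Module.Flat.trans A R P
  -- `P` is flat over `A`, so `P ⊗ p → P` is injective with image `p P`, and its source is
  -- projective over `R` because `p` is projective over `A`.
  let μ : P ⊗[A] p →ₗ[R] P := (TensorProduct.AlgebraTensorModule.rid A R P).toLinearMap ∘ₗ
    TensorProduct.AlgebraTensorModule.lTensor R P p.subtype
  have hμ : ∀ y a, μ (y ⊗ₜ a) = (a : A) • y := fun y a => rfl
  have hinj : Function.Injective μ :=
    (TensorProduct.AlgebraTensorModule.rid A R P).injective.comp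
      (Module.Flat.lTensor_preserves_injective_linearMap p.subtype p.subtype_injective)
  have hrange : LinearMap.range μ = p.map (algebraMap A R) • ⊤ := by
    refine le_antisymm ?_ (Submodule.smul_le.2 ?_)
    · rintro _ ⟨y, rfl⟩
      induction y using TensorProduct.induction_on with
      | zero => rw [map_zero]; exact zero_mem _
      | tmul y a =>
        rw [hμ]
        exact Submodule.smul_mem_smul (Ideal.mem_map_of_mem (algebraMap A R) a.2)
          (Submodule.mem_top (x := y))
      | add y z hy hz => rw [map_add]; exact add_mem hy hz
    · intro r hr y _
      refine Submodule.span_induction (p := fun r _ => r • y ∈ LinearMap.range μ) ?_ ?_ ?_ ?_ hr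
      · rintro _ ⟨a, ha, rfl⟩
        exact ⟨y ⊗ₜ ⟨a, ha⟩, (hμ _ _).trans (algebraMap_smul R a y).symm⟩
      · rw [zero_smul]; exact zero_mem _
      · intro a b _ _ ha hb
        rw [add_smul]; exact add_mem ha hb
      · intro a b _ hb
        rw [smul_eq_mul, mul_smul]; exact Submodule.smul_mem _ _ hb
  rw [← hrange]
  exact Module.Projective.of_equiv (LinearEquiv.ofInjective μ hinj)

variable {k : Type u} [Field k] {A : Type v} [CommRing A] [Algebra k A] {L : Type w} [Field L]
  [Algebra k L]

variable (L) in
/-- The map `L ⊗ A / p → (A ⊗ L) / p (A ⊗ L)`. -/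
def quotientMapHom (p : Ideal A) :
    L ⊗[k] (A ⧸ p) →ₐ[k] (A ⊗[k] L) ⧸ p.map (algebraMap A (A ⊗[k] L)) :=
  Algebra.TensorProduct.lift
    ((Ideal.Quotient.mkₐ k _).comp Algebra.TensorProduct.includeRight)
    (Ideal.Quotient.liftₐ p ((Ideal.Quotient.mkₐ k _).comp Algebra.TensorProduct.includeLeft)
      fun _ ha => Ideal.Quotient.eq_zero_iff_mem.2 (Ideal.mem_map_of_mem _ ha))
    fun _ _ => Commute.all _ _

lemma quotientMapHom_tmul (p : Ideal A) (l : L) (a : A) :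
    quotientMapHom (k := k) L p (l ⊗ₜ Ideal.Quotient.mk p a) = Ideal.Quotient.mk _ (a ⊗ₜ[k] l) := by
  refine (Algebra.TensorProduct.lift_tmul _ _ _ l _).trans ?_
  rw [mul_comm]
  change Ideal.Quotient.mk _ (a ⊗ₜ[k] (1 : L)) * Ideal.Quotient.mk _ ((1 : A) ⊗ₜ[k] l) = _
  rw [← map_mul, Algebra.TensorProduct.tmul_mul_tmul, mul_one, one_mul]

lemma quotientMapHom_surjective (p : Ideal A) :
    Function.Surjective (quotientMapHom (k := k) L p) := by
  intro y
  obtain ⟨y, rfl⟩ := Ideal.Quotient.mk_surjective y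
  induction y using TensorProduct.induction_on with
  | zero => exact ⟨0, by rw [map_zero, map_zero]⟩
  | tmul a l => exact ⟨_, quotientMapHom_tmul p l a⟩
  | add y z hy hz =>
    obtain ⟨a, ha⟩ := hy
    obtain ⟨b, hb⟩ := hz
    exact ⟨a + b, by rw [map_add, map_add, ha, hb]⟩

/-- `A/p` is finite over the perfect field `k`, hence separable, so `L ⊗ A/p` is reduced for every
extension `L`; being finite over `L`, it is also Artinian. -/
lemma isSemisimpleRing_quotient_map [PerfectField k] (p : Ideal A) [p.IsMaximal]
    [Module.Finite k (A ⧸ p)] :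
    IsSemisimpleRing ((A ⊗[k] L) ⧸ p.map (algebraMap A (A ⊗[k] L))) := by
  let _ : Field (A ⧸ p) := Ideal.Quotient.field p
  have : Algebra.IsAlgebraic k (A ⧸ p) := inferInstance
  have : Algebra.IsSeparable k (A ⧸ p) := Algebra.IsAlgebraic.isSeparable_of_perfectField
  have : Algebra.FormallyUnramified k (A ⧸ p) := .of_isSeparable _ _
  have : IsReduced (L ⊗[k] (A ⧸ p)) := Algebra.FormallyUnramified.isReduced_of_field L _
  have : IsArtinianRing (L ⊗[k] (A ⧸ p)) := IsArtinianRing.of_finite L _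
  have := IsArtinianRing.isSemisimpleRing_of_isReduced (L ⊗[k] (A ⧸ p))
  exact (quotientMapHom (k := k) L p).toRingHom.isSemisimpleRing_of_surjective
    (quotientMapHom_surjective p)

lemma projective_ideal [IsDedekindDomain A] (p : Ideal A) : Module.Projective A p :=
  have : Module.FinitePresentation A p := Module.finitePresentation_of_finite A p
  Module.Flat.projective_of_finitePresentation

/-- Submodules of projective `A ⊗ L`-modules which contain a nonzero multiple `a P`, `a ∈ A`, are
projective. -/
lemma projective_of_map_smul_top_le [PerfectField k] [IsDedekindDomain A]
    (hfin : ∀ a : A, a ≠ 0 → Module.Finite k (A ⧸ Ideal.span {a})) (I : Ideal A) (hI : I ≠ ⊥)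
    (P : Type x) [AddCommGroup P] [Module (A ⊗[k] L) P] [Module.Projective (A ⊗[k] L) P]
    (N : Submodule (A ⊗[k] L) P) (hN : I.map (algebraMap A (A ⊗[k] L)) • ⊤ ≤ N) :
    Module.Projective (A ⊗[k] L) N := by
  -- Dévissage: for an ideal `p I`, the module `N + p P` lies between `p P` and `P`, so it is
  -- projective by the semisimple case. It satisfies `I (N + p P) ⊆ N`, so the induction hypothesis
  -- applies with `N + p P` in place of `P`.
  induction I using UniqueFactorizationMonoid.induction_on_prime generalizing P with
  | h₁ => exact absurd rfl hI
  | h₂ I hu =>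
    rw [Ideal.isUnit_iff.1 hu, Ideal.map_top, Submodule.top_smul, top_le_iff] at hN
    rw [hN]
    exact Module.Projective.of_equiv Submodule.topEquiv.symm
  | h₃ I p hI0 hp ih =>
    have hp' := Ideal.isPrime_of_prime hp
    have := hp'.isMaximal hp.ne_zero
    obtain ⟨a, ha, ha0⟩ := Submodule.exists_mem_ne_zero_of_ne_bot hp.ne_zero
    have := hfin a ha0
    have hle := (Ideal.span_singleton_le_iff_mem p).2 ha
    have : Module.Finite k (A ⧸ p) :=
      Module.Finite.of_surjective (Ideal.Quotient.factorₐ k hle).toLinearMap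
        (Ideal.Quotient.factor_surjective hle)
    have := isSemisimpleRing_quotient_map (k := k) (L := L) p
    have := projective_ideal p
    set p' := p.map (algebraMap A (A ⊗[k] L))
    set N' : Submodule (A ⊗[k] L) P := N ⊔ p' • ⊤
    have hN' : Module.Projective (A ⊗[k] L) N' :=
      projective_of_smul_top_le p' (projective_map_smul_top P p)
        (isSemisimpleModule_quotient_smul_top P p') N' le_sup_right
    have hle' : I.map (algebraMap A (A ⊗[k] L)) • (⊤ : Submodule (A ⊗[k] L) N') ≤
        N.comap N'.subtype := by
      rw [← Submodule.map_le_iff_le_comap, Submodule.map_smul'', Submodule.map_top,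
        Submodule.range_subtype, Submodule.smul_sup, sup_le_iff]
      refine ⟨Submodule.smul_le_right, ?_⟩
      rwa [← Submodule.mul_smul, mul_comm, ← Ideal.map_mul]
    have := ih hI0 N' (N.comap N'.subtype) hle'
    exact Module.Projective.of_equiv (Submodule.comapSubtypeEquivOfLe (q := N') le_sup_left)

end Projective

/-! ### Dimension of the cokernel of `τ` under equivariant embeddings -/

section Dimension

variable {R : Type u} [CommRing R] {L : Type v} [Field L] [Algebra L R] (s : R →+* R)

instance {M : Type w} [AddCommGroup M] [Module R M] : Module L (Pullback s M) :=
  Module.compHom _ (algebraMap L R)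

instance {M : Type w} [AddCommGroup M] [Module R M] : IsScalarTower L R (Pullback s M) :=
  ⟨fun a r y => by rw [Algebra.smul_def, mul_smul]; rfl⟩

variable {M : Type w} [AddCommGroup M] [Module R M] [Module L M] [IsScalarTower L R M]
variable {M' : Type w} [AddCommGroup M'] [Module R M'] [Module L M'] [IsScalarTower L R M']

/-- Additivity along `0 → N/U → M/W → M/g(N) → 0`. Lengths in `ℕ∞` make finiteness assumptions
unnecessary here. -/
lemma length_quotient_eq_add {N : Type x} [AddCommGroup N] [Module R N] [Module L N]
    [IsScalarTower L R N] {g : N →ₗ[R] M} (hg : Function.Injective g) {U : Submodule R N}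
    {W : Submodule R M} (hU : U.map g = W) :
    Module.length L (M ⧸ W) =
      Module.length L (N ⧸ U) + Module.length L (M ⧸ LinearMap.range g) := by
  have hle : W ≤ LinearMap.range g := hU ▸ LinearMap.map_le_range
  let φ : (N ⧸ U) →ₗ[R] M ⧸ W := U.mapQ W g (Submodule.map_le_iff_le_comap.1 hU.le)
  let ψ : (M ⧸ W) →ₗ[R] M ⧸ LinearMap.range g := Submodule.factor hle
  have hφ : Function.Injective φ := by
    refine (injective_iff_map_eq_zero φ).2 fun y hy => ?_
    obtain ⟨y, rfl⟩ := U.mkQ_surjective y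
    have h1 : g y ∈ W := (Submodule.Quotient.mk_eq_zero W).1 hy
    rw [← hU] at h1
    obtain ⟨z, hz, hzy⟩ := h1
    exact (Submodule.Quotient.mk_eq_zero U).2 (hg hzy ▸ hz)
  have hex : Function.Exact φ ψ := by
    intro y
    obtain ⟨y, rfl⟩ := W.mkQ_surjective y
    constructor
    · intro hy
      obtain ⟨n, hn⟩ := (Submodule.Quotient.mk_eq_zero (LinearMap.range g)).1 hy
      exact ⟨U.mkQ n, congrArg W.mkQ hn⟩
    · rintro ⟨n, hn⟩
      obtain ⟨n, rfl⟩ := U.mkQ_surjective n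
      rw [← hn]
      exact (Submodule.Quotient.mk_eq_zero (LinearMap.range g)).2 ⟨n, rfl⟩
  exact Module.length_eq_add_of_exact (φ.restrictScalars L) (ψ.restrictScalars L) hφ
    (Submodule.factor_surjective hle) hex

omit [Module L M] [IsScalarTower L R M] in
/-- Pulling back does not increase the dimension of a cokernel. -/
lemma length_quotient_range_pullback_le
    (hs : ∀ a : L, ∃ a' : L, s (algebraMap L R a) = algebraMap L R a')
    (hspan : Submodule.span L {r : R | s r = r} = ⊤) (f : M →ₗ[R] M')
    [Module.Finite L (M' ⧸ LinearMap.range f)] :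
    Module.length L (Pullback s M' ⧸ LinearMap.range (Pullback.map s f)) ≤
      Module.length L (M' ⧸ LinearMap.range f) := by
  set K := LinearMap.range (Pullback.map s f)
  -- The classes of the elements `of (t i)` generate the pulled back cokernel over `L`: scalars from
  -- `L` pass through `of` to scalars from `L`, and `s`-fixed elements span `R` over `L`.
  -- Surjectivity of `s` on `L` is not needed.
  let b := Module.finBasis L (M' ⧸ LinearMap.range f)
  choose t ht using fun i => Submodule.mkQ_surjective _ (b i)
  let e : Fin (Module.finrank L (M' ⧸ LinearMap.range f)) → Pullback s M' ⧸ K :=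
    fun i => K.mkQ (.of s (t i))
  have hof : ∀ m : M', K.mkQ (.of s m) ∈ Submodule.span L (Set.range e) := by
    intro m
    have h1 : ∃ n, f n = m - ∑ i, b.repr ((LinearMap.range f).mkQ m) i • t i := by
      refine (Submodule.Quotient.mk_eq_zero (LinearMap.range f)).1 ?_
      change (LinearMap.range f).mkQ _ = 0
      rw [map_sub, map_sum, sub_eq_zero]
      conv_lhs => rw [← b.sum_repr ((LinearMap.range f).mkQ m)]
      refine Finset.sum_congr rfl fun i _ => ?_
      rw [← ht i]
      exact (((LinearMap.range f).mkQ.restrictScalars L).map_smul _ _).symm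
    obtain ⟨n, hn⟩ := h1
    have h2 : m = f n + ∑ i, algebraMap L R (b.repr ((LinearMap.range f).mkQ m) i) • t i := by
      rw [hn]
      simp only [algebraMap_smul, sub_add_cancel]
    let ofHom : M' →+ Pullback s M' :=
      { toFun := Pullback.of s, map_zero' := Pullback.of_zero s, map_add' := Pullback.of_add s }
    have h3 : Pullback.of s m = Pullback.map s f (.of s n) +
        ∑ i, Pullback.of s (algebraMap L R (b.repr ((LinearMap.range f).mkQ m) i) • t i) := by
      conv_lhs => rw [h2]
      exact (map_add ofHom _ _).trans (congrArg _ (map_sum ofHom _ _))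
    rw [h3, map_add, map_sum]
    refine add_mem ?_ (sum_mem fun i _ => ?_)
    · have : K.mkQ (Pullback.map s f (.of s n)) = 0 :=
        (Submodule.Quotient.mk_eq_zero K).2 ⟨_, rfl⟩
      rw [this]
      exact zero_mem _
    · obtain ⟨a', ha'⟩ := hs (b.repr ((LinearMap.range f).mkQ m) i)
      rw [Pullback.of_smul, ha', map_smul, algebraMap_smul]
      exact Submodule.smul_mem _ _ (Submodule.subset_span ⟨i, rfl⟩)
  have htop : Submodule.span L (Set.range e) = ⊤ := by
    rw [eq_top_iff]
    rintro y -
    obtain ⟨y, rfl⟩ := K.mkQ_surjective y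
    induction y using Pullback.induction with
    | h a m =>
      have ha : a ∈ Submodule.span L {r : R | s r = r} := hspan ▸ Submodule.mem_top
      induction ha using Submodule.span_induction with
      | mem a ha =>
        rw [← (show s a = a from ha), ← Pullback.of_smul]
        exact hof _
      | zero => rw [zero_smul, map_zero]; exact zero_mem _
      | add a a' _ _ h h' => rw [add_smul, map_add]; exact add_mem h h'
      | smul l a _ h =>
        rw [Algebra.smul_def, mul_smul, map_smul, algebraMap_smul]
        exact Submodule.smul_mem _ _ h
    | hadd y y' hy hy' => rw [map_add]; exact add_mem hy hy'
  have hfin : Module.Finite L (Pullback s M' ⧸ K) :=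
    ⟨htop ▸ Submodule.fg_span (Set.finite_range e)⟩
  rw [Module.length_eq_finrank, Module.length_eq_finrank, Nat.cast_le]
  have h4 := finrank_range_le_card (R := L) e
  rwa [Set.finrank, htop, finrank_top, Fintype.card_fin] at h4

/-- A `τ`-equivariant embedding with finite-dimensional cokernel does not decrease the dimension of
the cokernel of `τ`. -/
lemma length_coker_le
    (hs : ∀ a : L, ∃ a' : L, s (algebraMap L R a) = algebraMap L R a')
    (hspan : Submodule.span L {r : R | s r = r} = ⊤)
    {τ : Pullback s M →ₗ[R] M} {τ' : Pullback s M' →ₗ[R] M'} (hτ' : Function.Injective τ')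
    {f : M →ₗ[R] M'} (hf : Function.Injective f)
    (hfτ : ∀ y, f (τ y) = τ' (Pullback.map s f y)) [Module.Finite L (M' ⧸ LinearMap.range f)] :
    Module.length L (M ⧸ LinearMap.range τ) ≤ Module.length L (M' ⧸ LinearMap.range τ') := by
  -- The length of `M'/W` is computed along the two factorizations `f ∘ τ = τ' ∘ s^* f`. The
  -- cokernel of `s^* f` is no larger than that of `f`, whose finite length then cancels.
  set W := LinearMap.range (f ∘ₗ τ)
  have hW : W = LinearMap.range (τ' ∘ₗ Pullback.map s f) := by
    rw [← (LinearMap.ext hfτ : f ∘ₗ τ = τ' ∘ₗ Pullback.map s f)]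
  have h1 := length_quotient_eq_add (L := L) hf (U := LinearMap.range τ) (LinearMap.range_comp τ f).symm
  have h2 := length_quotient_eq_add (L := L) hτ' (U := LinearMap.range (Pullback.map s f)) (W := W)
    (by rw [hW, LinearMap.range_comp])
  have h3 := length_quotient_range_pullback_le s hs hspan f
  have hne : Module.length L (M' ⧸ LinearMap.range f) ≠ ⊤ := Module.length_ne_top
  rw [h1] at h2
  have h4 : Module.length L (M ⧸ LinearMap.range τ) + Module.length L (M' ⧸ LinearMap.range f) ≤
      Module.length L (M' ⧸ LinearMap.range τ') + Module.length L (M' ⧸ LinearMap.range f) := by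
    rw [h2, add_comm]
    exact add_le_add_right h3 _
  exact (ENat.add_le_add_iff_right hne).1 h4

end Dimension

/-! ### Ranks, finiteness over `L`, and base change of `A/p` -/

section Auxiliary

lemma rankAtStalk_le_of_injective {R : Type u} [CommRing R] {M N : Type v} [AddCommGroup M]
    [Module R M] [AddCommGroup N] [Module R N] [Module.Finite R N] (f : M →ₗ[R] N)
    (hf : Function.Injective f) (p : PrimeSpectrum R) :
    Module.rankAtStalk M p ≤ Module.rankAtStalk N p :=
  LinearMap.finrank_le_finrank_of_injective (f := IsLocalizedModule.mapExtendScalars p.asIdeal.primeCompl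
    (LocalizedModule.mkLinearMap p.asIdeal.primeCompl M)
    (LocalizedModule.mkLinearMap p.asIdeal.primeCompl N) (Localization.AtPrime p.asIdeal) f)
    (IsLocalizedModule.map_injective p.asIdeal.primeCompl _ _ f hf)

lemma finite_of_smul_eq_zero {R : Type u} [CommRing R] {L : Type v} [Field L] [Algebra L R]
    {X : Type w} [AddCommGroup X] [Module R X] [Module L X] [IsScalarTower L R X]
    [Module.Finite R X] (I : Ideal R) [Module.Finite L (R ⧸ I)] (h : ∀ a ∈ I, ∀ y : X, a • y = 0) :
    Module.Finite L X := by
  have hI : Module.IsTorsionBySet R X I := fun y a => h a a.2 y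
  let _ : Module (R ⧸ I) X := hI.module
  have : IsScalarTower R (R ⧸ I) X := hI.isScalarTower
  have : IsScalarTower L (R ⧸ I) X := hI.isScalarTower
  have : Module.Finite (R ⧸ I) X := Module.Finite.of_restrictScalars_finite R _ _
  exact Module.Finite.trans (R ⧸ I) X

lemma finite_of_length_eq {L : Type u} [Field L] {X : Type v} [AddCommGroup X] [Module L X] {d : ℕ}
    (h : Module.length L X = d) : Module.Finite L X ∧ Module.finrank L X = d := by
  have h1 : IsFiniteLength L X := Module.length_ne_top_iff.1 (by rw [h]; exact ENat.natCast_ne_top d)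
  have h2 := (isFiniteLength_iff_isNoetherian_isArtinian.1 h1).1
  have h3 : Module.Finite L X := inferInstance
  exact ⟨h3, by rw [Module.length_eq_finrank] at h; exact_mod_cast h⟩

variable {k : Type u} [Field k] {A : Type v} [CommRing A] [Algebra k A] {L : Type w} [Field L]
  [Algebra k L]

lemma finite_quotient_map (p : Ideal A) [Module.Finite k (A ⧸ p)] :
    let _ : Algebra L (A ⊗[k] L) := Algebra.TensorProduct.includeRight.toRingHom.toAlgebra
    Module.Finite L ((A ⊗[k] L) ⧸ p.map (algebraMap A (A ⊗[k] L))) := by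
  intro _
  let φ : L ⊗[k] (A ⧸ p) →ₗ[L] (A ⊗[k] L) ⧸ p.map (algebraMap A (A ⊗[k] L)) :=
    { toFun := quotientMapHom L p
      map_add' := map_add _
      map_smul' := fun l y => by
        have h1 : l • y = (l ⊗ₜ 1) * y := Algebra.smul_def l y
        have h2 : quotientMapHom L p (l ⊗ₜ (1 : A ⧸ p)) =
            algebraMap L ((A ⊗[k] L) ⧸ p.map (algebraMap A (A ⊗[k] L))) l :=
          quotientMapHom_tmul p l 1
        rw [h1, map_mul, h2]
        exact (Algebra.smul_def l (quotientMapHom L p y)).symm }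
  exact Module.Finite.of_surjective φ (quotientMapHom_surjective p)

end Auxiliary

/-! ### Flatness of Frobenius and cancellation of scalars -/

section Frobenius

variable {Fq : Type u} [Field Fq] [Fintype Fq] {B : Type v} [CommRing B] [Algebra Fq B]
  {L : Type w} [Field L] [Algebra Fq L]

lemma frob_tmul (b : B) (l : L) :
    frob Fq L B (b ⊗ₜ l) = b ⊗ₜ (l ^ Fintype.card Fq) := rfl

instance flat_twist_frob : Module.Flat (B ⊗[Fq] L) (Twist (frob Fq L B)) :=
  (RingHom.Flat.tensorProductMap (f := AlgHom.id Fq B) (g := FiniteField.frobeniusAlgHom Fq L)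
      (RingHom.Flat.id _) (RingHom.Flat.of_isField (Field.toIsField L) _) :
    (frob Fq L B).Flat)

/-- Flatness of `R` over `A` keeps `a` a nonzerodivisor in `R`, and flatness of `M` over `R` keeps
it regular on `M`. Scalars from `A` can thus be cancelled without knowing that `A ⊗ L` is a domain.
-/
lemma smul_eq_zero_of_projective {A : Type u} {R : Type v} [CommRing A] [IsDomain A] [CommRing R]
    [Algebra A R] [Module.Flat A R] {M : Type w} [AddCommGroup M] [Module R M] (hM : Module.Projective R M)
    {a : A} (ha : a ≠ 0) {m : M} (h : algebraMap A R a • m = 0) : m = 0 := by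
  have h1 : algebraMap A R a ∈ R⁰ := by
    have h2 := Module.Flat.isSMulRegular_of_nonZeroDivisors (M := R) (mem_nonZeroDivisors_of_ne_zero ha)
    refine mem_nonZeroDivisors_iff_right.2 fun r hr => h2 (?_ : a • r = a • (0 : R))
    rw [smul_zero, Algebra.smul_def, mul_comm, hr]
  refine Module.Flat.isSMulRegular_of_nonZeroDivisors (M := M) h1 (?_ : _ • m = _ • (0 : M))
  rw [h, smul_zero]

end Frobenius

/-! ### Invariance of purity under isogeny -/

section Generic

variable {Fq : Type u} {Q : Type v} [Field Fq] [Fintype Fq] [Field Q] [Algebra Fq Q]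
variable {inf : Place Fq Q} {L : Type w} [Field L] [Algebra Fq L]
variable {M : Type x} [AddCommGroup M] [Module (AL inf L) M]
variable {N : Type x} [AddCommGroup N] [Module (AL inf L) N]

lemma genericTau_tmul (τ : Pullback (frob Fq L (regularAway inf)) M →ₗ[AL inf L] M)
    (y : FunctionFieldL Fq Q L) (m : M) :
    genericTau τ (y ⊗ₜ m) = frobFunctionField Fq Q L y ⊗ₜ τ (.of _ m) := rfl

/-- Purity depends only on the generic stalk. -/
lemma IsPureAt.of_equiv {τ : Pullback (frob Fq L (regularAway inf)) M →ₗ[AL inf L] M}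
    {τ' : Pullback (frob Fq L (regularAway inf)) N →ₗ[AL inf L] N} {r : ℕ} (h : IsPureAt τ r)
    (e : Generic inf L N ≃ₗ[FunctionFieldL Fq Q L] Generic inf L M)
    (he : ∀ y, e (genericTau τ' y) = genericTau τ (e y)) : IsPureAt τ' r := by
  obtain ⟨b, k, l, z, hk, hl, hz, hb⟩ := h
  refine ⟨b.map e.symm, k, l, z, hk, hl, hz, fun y => ?_⟩
  let e' : Generic inf L N →ₗ[stalk inf L] Generic inf L M :=
    { toFun := e, map_add' := map_add e, map_smul' := fun a y => e.map_smul (a : FunctionFieldL Fq Q L) y }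
  have hinj : Function.Injective e' := e.injective
  have hspan : ∀ (s : Set (Generic inf L N)) (y : Generic inf L N),
      y ∈ Submodule.span (stalk inf L) s ↔ e y ∈ Submodule.span (stalk inf L) (e '' s) := by
    intro s y
    have h1 : Submodule.span (stalk inf L) (e '' s) = (Submodule.span (stalk inf L) s).map e' :=
      (Submodule.map_span e' s).symm
    rw [h1]
    exact (hinj.mem_set_image (s := (Submodule.span (stalk inf L) s : Set (Generic inf L N)))).symm
  have hrange : e '' Set.range (b.map e.symm) = Set.range b := by
    rw [← Set.range_comp]
    congr 1
    funext i
    simp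
  have hlat : ∀ y, y ∈ Submodule.span (stalk inf L) (Set.range (b.map e.symm)) ↔
      e y ∈ Submodule.span (stalk inf L) (Set.range b) := fun y => by rw [hspan, hrange]
  have hiter : ∀ n y, e ((genericTau τ')^[n] y) = (genericTau τ)^[n] (e y) := fun n y =>
    (Function.Semiconj.iterate_right (f := e) he n) y
  have himage : e '' ((genericTau τ')^[l] ''
      (Submodule.span (stalk inf L) (Set.range (b.map e.symm)) : Set (Generic inf L N))) =
      (genericTau τ)^[l] '' (Submodule.span (stalk inf L) (Set.range b) : Set (Generic inf L M)) := by
    ext m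
    constructor
    · rintro ⟨_, ⟨y, hy, rfl⟩, rfl⟩
      exact ⟨e y, (hlat y).1 hy, (hiter l y).symm⟩
    · rintro ⟨y, hy, rfl⟩
      refine ⟨_, ⟨e.symm y, (hlat _).2 (by rwa [e.apply_symm_apply]), rfl⟩, ?_⟩
      rw [hiter, e.apply_symm_apply]
  rw [hspan, himage, hb (e y), hlat, map_smul]

omit [Fintype Fq] in
lemma isUnit_algebraMap_tmul_one {a : regularAway inf} (ha : a ≠ 0) :
    IsUnit (algebraMap (AL inf L) (FunctionFieldL Fq Q L) (a ⊗ₜ 1)) := by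
  have h : IsUnit ((a : Q) ⊗ₜ[Fq] (1 : L)) := by
    refine IsUnit.of_mul_eq_one ((a : Q)⁻¹ ⊗ₜ 1) ?_
    rw [Algebra.TensorProduct.tmul_mul_tmul, mul_inv_cancel₀ (fun h => ha (Subtype.ext h)), mul_one]
    rfl
  exact h.map (inclQL Fq Q L)

/-- An isogeny induces an isomorphism of the generic stalks. -/
lemma IsPureAt.of_isogeny {τ : Pullback (frob Fq L (regularAway inf)) M →ₗ[AL inf L] M}
    {τ' : Pullback (frob Fq L (regularAway inf)) N →ₗ[AL inf L] N} {r : ℕ} (h : IsPureAt τ r)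
    (f : N →ₗ[AL inf L] M) (hf : ∀ y, f (τ' y) = τ (Pullback.map _ f y))
    (g : M →ₗ[AL inf L] N) {a : regularAway inf} (ha : a ≠ 0)
    (hfg : ∀ m, f (g m) = (a ⊗ₜ[Fq] (1 : L) : AL inf L) • m)
    (hgf : ∀ m, g (f m) = (a ⊗ₜ[Fq] (1 : L) : AL inf L) • m) : IsPureAt τ' r := by
  let F : Generic inf L N →ₗ[FunctionFieldL Fq Q L] Generic inf L M :=
    TensorProduct.AlgebraTensorModule.lTensor _ _ f
  let G : Generic inf L M →ₗ[FunctionFieldL Fq Q L] Generic inf L N :=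
    TensorProduct.AlgebraTensorModule.lTensor _ _ g
  have hFG : ∀ y, F (G y) = algebraMap (AL inf L) (FunctionFieldL Fq Q L) (a ⊗ₜ 1) • y := by
    intro y
    induction y using TensorProduct.induction_on with
    | zero => simp
    | tmul y m =>
      change y ⊗ₜ[AL inf L] f (g m) = _
      rw [hfg, algebraMap_smul, TensorProduct.tmul_smul]
    | add y z hy hz => rw [map_add, map_add, hy, hz, smul_add]
  have hGF : ∀ y, G (F y) = algebraMap (AL inf L) (FunctionFieldL Fq Q L) (a ⊗ₜ 1) • y := by
    intro y
    induction y using TensorProduct.induction_on with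
    | zero => simp
    | tmul y m =>
      change y ⊗ₜ[AL inf L] g (f m) = _
      rw [hgf, algebraMap_smul, TensorProduct.tmul_smul]
    | add y z hy hz => rw [map_add, map_add, hy, hz, smul_add]
  -- `a` is invertible in the function field, so `F G = a = G F` makes `F` bijective.
  have hu := isUnit_algebraMap_tmul_one (L := L) ha
  have hbij : Function.Bijective F := by
    constructor
    · refine (injective_iff_map_eq_zero F).2 fun y hy => ?_
      have h1 := hGF y
      rw [hy, map_zero] at h1
      exact (hu.smul_eq_zero).1 h1.symm
    · intro y
      obtain ⟨v, hv⟩ := hu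
      refine ⟨G (v⁻¹ • y), ?_⟩
      rw [hFG, ← hv]
      exact smul_inv_smul v y
  refine h.of_equiv (LinearEquiv.ofBijective F hbij) fun y => ?_
  change F _ = genericTau τ (F y)
  induction y using TensorProduct.induction_on with
  | zero => simp only [map_zero]
  | tmul y m =>
    rw [genericTau_tmul]
    change frobFunctionField Fq Q L y ⊗ₜ[AL inf L] f (τ' (.of _ m)) =
      frobFunctionField Fq Q L y ⊗ₜ[AL inf L] τ (.of _ (f m))
    rw [hf, Pullback.map_of]
  | add y z hy hz => rw [map_add, map_add, map_add, map_add, hy, hz]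

end Generic

/-! ### The submodule generated by the images of finitely many endomorphisms -/

section ImageModule

lemma Pullback.map_comp {R : Type u} [CommRing R] (s : R →+* R) {M₁ M₂ M₃ : Type*}
    [AddCommGroup M₁] [Module R M₁] [AddCommGroup M₂] [Module R M₂] [AddCommGroup M₃] [Module R M₃]
    (g : M₂ →ₗ[R] M₃) (f : M₁ →ₗ[R] M₂) (y : Pullback s M₁) :
    Pullback.map s g (Pullback.map s f y) = Pullback.map s (g ∘ₗ f) y :=
  LinearMap.congr_fun (f := Pullback.map s g ∘ₗ Pullback.map s f) (g := Pullback.map s (g ∘ₗ f))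
    (Pullback.map_ext s fun _ => rfl) y

variable {R : Type u} [CommRing R] {s : R →+* R} {M : Type v} [AddCommGroup M] [Module R M]
  {ι : Type w} (t : ι → Module.End R M)

/-- The submodule of `M` generated by the images of the endomorphisms `t i`. -/
def imageModule : Submodule R M := ⨆ i, LinearMap.range (t i)

/-- The endomorphism `t i` as a map to the submodule generated by the images. -/
def toImage (i : ι) : M →ₗ[R] imageModule t :=
  LinearMap.codRestrict _ (t i) fun m => le_iSup (fun i => LinearMap.range (t i)) i ⟨m, rfl⟩

lemma imageModule_induction {p : imageModule t → Prop} (h0 : p 0)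
    (hadd : ∀ a b, p a → p b → p (a + b)) (ht : ∀ i m, p (toImage t i m)) (y) : p y := by
  obtain ⟨y, hy⟩ := y
  refine Submodule.iSup_induction' _ (motive := fun y hy => p ⟨y, hy⟩) ?_ h0
    (fun a b ha hb h h' => hadd _ _ h h') hy
  rintro i _ ⟨m, rfl⟩
  exact ht i m

lemma fg_imageModule [Finite ι] [Module.Finite R M] : (imageModule t).FG :=
  Submodule.fg_iSup _ fun i => by
    rw [LinearMap.range_eq_map]; exact Module.Finite.fg_top.map _

variable (τ : Pullback s M →ₗ[R] M) (ht : ∀ i y, t i (τ y) = τ (Pullback.map s (t i) y))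

-- Each `t i` commutes with `τ`, so `τ` carries the pullback of `t i (M)` into `t i (M)`.
include ht in
lemma tau_map_subtype_mem (y) : τ (Pullback.map s (imageModule t).subtype y) ∈ imageModule t := by
  induction y using Pullback.induction with
  | h a m =>
    rw [map_smul, map_smul]
    refine Submodule.smul_mem _ _ ?_
    induction m using imageModule_induction with
    | h0 => rw [Pullback.of_zero, map_zero, map_zero]; exact zero_mem _
    | hadd a b ha hb => rw [Pullback.of_add, map_add, map_add]; exact add_mem ha hb
    | ht i m =>
      rw [Pullback.map_of]
      change τ (Pullback.of s (t i m)) ∈ _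
      rw [← Pullback.map_of, ← ht]
      exact (toImage t i _).2
  | hadd y z hy hz => rw [map_add, map_add]; exact add_mem hy hz

/-- The restriction of `τ` to the submodule generated by the images of the `t i`. -/
def imageTau : Pullback s (imageModule t) →ₗ[R] imageModule t :=
  LinearMap.codRestrict _ (τ ∘ₗ Pullback.map s (imageModule t).subtype)
    (tau_map_subtype_mem t τ ht)

/-- The cokernel of `τ` on the submodule generated by the images of the `t i`. -/
abbrev ImageCoker : Type v := imageModule t ⧸ LinearMap.range (imageTau t τ ht)

lemma subtype_imageTau (y) : (imageModule t).subtype (imageTau t τ ht y) =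
    τ (Pullback.map s (imageModule t).subtype y) := rfl

lemma pullback_map_injective (s : R →+* R) [Module.Flat R (Twist s)]
    {N : Type w} [AddCommGroup N] [Module R N]
    (f : M →ₗ[R] N) (hf : Function.Injective f) : Function.Injective (Pullback.map s f) :=
  Module.Flat.lTensor_preserves_injective_linearMap (M := Twist s) f hf

lemma imageTau_injective [Module.Flat R (Twist s)] (hτ : Function.Injective τ) :
    Function.Injective (imageTau t τ ht) := by
  intro y z h
  have h1 := congrArg (imageModule t).subtype h
  exact pullback_map_injective s _ (imageModule t).subtype_injective (hτ h1)

lemma toImage_tau (i : ι) (y) :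
    toImage t i (τ y) = imageTau t τ ht (Pullback.map s (toImage t i) y) := by
  refine Subtype.ext ((ht i y).trans ?_)
  change _ = τ (Pullback.map s (imageModule t).subtype (Pullback.map s (toImage t i) y))
  rw [Pullback.map_comp]
  rfl

/-- `j` commutes with `t i`, and `t i` maps the image of `τ` into the image of the restricted `τ`.
The same power of `J` therefore annihilates the new cokernel. -/
lemma smul_mem_range_imageTau {j : R} (hj : ∀ m : M, j • m ∈ LinearMap.range τ)
    (y : imageModule t) : j • y ∈ LinearMap.range (imageTau t τ ht) := by
  induction y using imageModule_induction with
  | h0 => rw [smul_zero]; exact zero_mem _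
  | hadd a b ha hb => rw [smul_add]; exact add_mem ha hb
  | ht i m =>
    obtain ⟨z, hz⟩ := hj m
    rw [← map_smul, ← hz, toImage_tau t τ ht]
    exact ⟨_, rfl⟩

variable {t} {a : R} (hat : ∀ m : M, a • m ∈ imageModule t)

/-- Multiplication by `a` as a map to the submodule generated by the images. -/
def mulToImage : M →ₗ[R] imageModule t :=
  LinearMap.codRestrict _ (algebraMap R (Module.End R M) a) hat

lemma mulToImage_injective (ha : ∀ m : M, a • m = 0 → m = 0) :
    Function.Injective (mulToImage hat) :=
  (injective_iff_map_eq_zero _).2 fun m hm => ha m (congrArg Subtype.val hm)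

lemma mulToImage_tau (hsa : s a = a) (y) :
    mulToImage hat (τ y) = imageTau t τ ht (Pullback.map s (mulToImage hat) y) := by
  refine Subtype.ext ?_
  change a • τ y = τ (Pullback.map s (imageModule t).subtype (Pullback.map s (mulToImage hat) y))
  rw [Pullback.map_comp]
  change _ = τ (Pullback.map s (algebraMap R (Module.End R M) a) y)
  rw [Pullback.map_algebraMap, hsa, map_smul]

include hat in
/-- The cokernel of `τ` on the submodule generated by the images has the same dimension. -/
lemma length_coker_imageTau [Finite ι] [Module.Finite R M] [Module.Flat R (Twist s)]
    {L : Type x} [Field L] [Algebra L R] [Module L M] [IsScalarTower L R M]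
    [Module.Finite L (R ⧸ Ideal.span {a})] (hs : ∀ a : L, ∃ a' : L, s (algebraMap L R a) = algebraMap L R a')
    (hspan : Submodule.span L {r : R | s r = r} = ⊤) (hτ : Function.Injective τ)
    (ha : ∀ m : M, a • m = 0 → m = 0) (hsa : s a = a) :
    Module.length L (imageModule t ⧸ LinearMap.range (imageTau t τ ht)) =
      Module.length L (M ⧸ LinearMap.range τ) := by
  have : Module.Finite R (imageModule t) := Module.Finite.iff_fg.2 (fg_imageModule t)
  have : Module.Finite L (M ⧸ LinearMap.range (imageModule t).subtype) :=
    finite_of_smul_eq_zero (Ideal.span {a}) fun r hr y => by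
      obtain ⟨r, rfl⟩ := Ideal.mem_span_singleton'.1 hr
      obtain ⟨y, rfl⟩ := Submodule.mkQ_surjective _ y
      have h1 : (LinearMap.range (imageModule t).subtype).mkQ (a • y) = 0 :=
        (Submodule.Quotient.mk_eq_zero _).2 ⟨⟨_, hat y⟩, rfl⟩
      rw [mul_smul, ← map_smul, h1, smul_zero]
  have : Module.Finite L (imageModule t ⧸ LinearMap.range (mulToImage hat)) :=
    finite_of_smul_eq_zero (Ideal.span {a}) fun r hr y => by
      obtain ⟨r, rfl⟩ := Ideal.mem_span_singleton'.1 hr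
      obtain ⟨y, rfl⟩ := Submodule.mkQ_surjective _ y
      have h1 : (LinearMap.range (mulToImage hat)).mkQ (a • y) = 0 :=
        (Submodule.Quotient.mk_eq_zero _).2 ⟨y, rfl⟩
      rw [mul_smul, ← map_smul, h1, smul_zero]
  -- The inclusion of the submodule into `M` and multiplication by `a` in the other direction are
  -- both equivariant with finite-dimensional cokernel; each gives one inequality.
  exact le_antisymm
    (length_coker_le s hs hspan hτ (imageModule t).subtype_injective (subtype_imageTau t τ ht))
    (length_coker_le s hs hspan (imageTau_injective t τ ht hτ) (mulToImage_injective hat ha)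
      (mulToImage_tau τ ht hat hsa))

end ImageModule

/-! ### The image submodule as a pure Anderson motive -/

section ImageMotive

variable {Fq : Type u} {Q : Type v} [Field Fq] [Field Q] [Algebra Fq Q]
variable {inf : Place Fq Q} {L : Type w} [Field L] [Algebra Fq L]

/-- `HasLDim` carries its own `L`-module structure. Here it is identified with an ambient one and
expressed by a length in `ℕ∞`, which records finiteness at the same time. -/
lemma hasLDim_iff_length {X : Type x} [AddCommGroup X] [Module (AL inf L) X] [inst : Module L X]
    (h : ∀ (l : L) (y : X), l • y = ((1 : regularAway inf) ⊗ₜ[Fq] l : AL inf L) • y) {d : ℕ} :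
    HasLDim (inf := inf) (L := L) X d ↔ Module.length L X = d := by
  have : Module.compHom X
    (Algebra.TensorProduct.includeRight : L →ₐ[Fq] AL inf L).toRingHom = inst :=
    Module.ext' _ _ fun l y => (h l y).symm
  unfold HasLDim
  rw [this]
  refine ⟨fun ⟨h1, h2⟩ => ?_, finite_of_length_eq⟩
  rw [Module.length_eq_finrank, h2]

variable [Fintype Fq] {c : regularAway inf →ₐ[Fq] L}

/-- The fixed elements `b ⊗ 1` already span. This is the input for comparing the dimension of a
cokernel with that of its pullback. -/
lemma span_frob_fixed :
    let _ : Algebra L (AL inf L) :=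
      (Algebra.TensorProduct.includeRight : L →ₐ[Fq] AL inf L).toRingHom.toAlgebra
    Submodule.span L {r : AL inf L | frob Fq L (regularAway inf) r = r} = ⊤ := by
  intro _
  rw [eq_top_iff]
  rintro r -
  induction r using TensorProduct.induction_on with
  | zero => exact zero_mem _
  | tmul b l =>
    have h : (b ⊗ₜ[Fq] l : AL inf L) = l • (b ⊗ₜ[Fq] (1 : L) : AL inf L) := by
      refine Eq.trans ?_ (Algebra.smul_def (A := AL inf L) l _).symm
      refine Eq.trans ?_ (Algebra.TensorProduct.tmul_mul_tmul (1 : regularAway inf) b l 1).symm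
      rw [one_mul, mul_one]
    rw [h]
    refine Submodule.smul_mem _ _ (Submodule.subset_span ?_)
    exact (frob_tmul b (1 : L)).trans (by rw [one_pow])
  | add a b ha hb => exact add_mem ha hb

omit [Fintype Fq] in
lemma map_span_singleton_eq (a : regularAway inf) :
    (Ideal.span {a}).map (algebraMap (regularAway inf) (AL inf L)) =
      Ideal.span {(a ⊗ₜ[Fq] (1 : L) : AL inf L)} := by
  rw [Ideal.map_span, Set.image_singleton]
  rfl

variable (M : PureMotive.{u, v, w, x} c)

lemma PureMotive.smul_eq_zero [IsDomain (regularAway inf)] {a : regularAway inf} (ha : a ≠ 0)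
    (m : M.carrier) (h : (a ⊗ₜ[Fq] (1 : L) : AL inf L) • m = 0) : m = 0 :=
  smul_eq_zero_of_projective (A := regularAway inf) (R := AL inf L) M.projective ha h

variable {ι : Type} (t : ι → End M)

lemma End.apply_tau {M : PureMotive.{u, v, w, x} c} (f : End M) (y) :
    f.1 (M.τ y) = M.τ (Pullback.map _ f.1 y) :=
  isMorphism_iff.1 f.2 y

variable {t} {a : regularAway inf}
  (hat : ∀ m : M.carrier, (a ⊗ₜ[Fq] (1 : L) : AL inf L) • m ∈ imageModule fun i => (t i).1)

include hat in
lemma hasLDim_image [Finite ι] (hfin : Module.Finite Fq (regularAway inf ⧸ Ideal.span {a}))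
    [IsDomain (regularAway inf)] (ha : a ≠ 0) :
    HasLDim (inf := inf) (L := L)
      (ImageCoker (fun i => (t i).1) M.τ fun i => End.apply_tau (t i)) M.dim := by
  have := M.finite
  let _ : Algebra L (AL inf L) :=
    (Algebra.TensorProduct.includeRight : L →ₐ[Fq] AL inf L).toRingHom.toAlgebra
  let _ : Module L M.carrier := Module.compHom _ (algebraMap L (AL inf L))
  have : IsScalarTower L (AL inf L) M.carrier := ⟨fun l r y => by
    rw [Algebra.smul_def, mul_smul]; rfl⟩
  have hquot := finite_quotient_map (k := Fq) (L := L) (Ideal.span {a})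
  rw [map_span_singleton_eq] at hquot
  have hs : ∀ l : L, ∃ l' : L, frob Fq L (regularAway inf) (algebraMap L (AL inf L) l) =
      algebraMap L (AL inf L) l' := fun l => ⟨_, frob_tmul 1 l⟩
  have h1 := length_coker_imageTau M.τ (fun i => End.apply_tau (t i)) hat hs span_frob_fixed
    M.τ_injective (M.smul_eq_zero ha) ((frob_tmul a (1 : L)).trans (by rw [one_pow]))
  have hsmul : ∀ {X : Type x} [AddCommGroup X] [Module (AL inf L) X] [Module L X]
      [IsScalarTower L (AL inf L) X] (l : L) (y : X),
      l • y = ((1 : regularAway inf) ⊗ₜ[Fq] l : AL inf L) • y := fun l y =>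
    (algebraMap_smul (AL inf L) l y).symm
  exact (hasLDim_iff_length hsmul).2 (h1.trans ((hasLDim_iff_length hsmul).1 M.coker_dim))

/-- The pure Anderson motive generated by the images of the endomorphisms `t i`. -/
def imageMotive (hQ : IsCurveFunctionField Fq Q) [Finite ι] (ha : a ≠ 0) :
    PureMotive.{u, v, w, x} c where
  carrier := imageModule fun i => (t i).1
  rank := M.rank
  dim := M.dim
  finite := have := M.finite; Module.Finite.iff_fg.2 (fg_imageModule _)
  projective := by
    have := M.projective
    have := isDedekindDomain_regularAway hQ inf
    refine projective_of_map_smul_top_le (finite_quotient_regularAway hQ inf) (Ideal.span {a})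
      (by simpa using ha) M.carrier (imageModule fun i => (t i).1)
      (Submodule.smul_le.2 fun r hr y _ => ?_)
    rw [map_span_singleton_eq, Ideal.mem_span_singleton'] at hr
    obtain ⟨r, rfl⟩ := hr
    rw [mul_smul]
    exact Submodule.smul_mem _ _ (hat y)
  rankAtStalk_eq p := by
    have := M.finite
    have := isDedekindDomain_regularAway hQ inf
    have : Module.Finite (AL inf L) (imageModule fun i => (t i).1) :=
      Module.Finite.iff_fg.2 (fg_imageModule _)
    rw [← M.rankAtStalk_eq p]
    exact le_antisymm (rankAtStalk_le_of_injective _ (Submodule.subtype_injective _) p)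
      (rankAtStalk_le_of_injective (mulToImage hat)
        (mulToImage_injective hat (M.smul_eq_zero ha)) p)
  τ := imageTau (fun i => (t i).1) M.τ fun i => End.apply_tau (t i)
  τ_injective := imageTau_injective _ _ _ M.τ_injective
  coker_dim :=
    have := isDedekindDomain_regularAway hQ inf
    hasLDim_image M hat (finite_quotient_regularAway hQ inf a ha) ha
  coker_annihilated j hj y := by
    obtain ⟨y, rfl⟩ := Submodule.mkQ_surjective _ y
    refine (Submodule.Quotient.mk_eq_zero _).2 (smul_mem_range_imageTau _ _ _ (fun m => ?_) y)
    exact (Submodule.Quotient.mk_eq_zero _).1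
      (M.coker_annihilated j hj ((LinearMap.range M.τ).mkQ m))
  pure := M.pure.of_isogeny (imageModule fun i => (t i).1).subtype (subtype_imageTau _ _ _)
    (mulToImage hat) ha (fun _ => rfl) (fun _ => rfl)

end ImageMotive

/-! ### Finite generation of endomorphism rings; denominators of orders -/

section Orders

/-- A module of finite rank over a noetherian domain which embeds into a free module is finitely
generated. -/
lemma finite_of_injective_free {A : Type u} {Q : Type v} [CommRing A] [IsDomain A]
    [IsNoetherianRing A] [Field Q] [Algebra A Q] [IsFractionRing A Q] {O : Type w} [AddCommGroup O]
    [Module A O] {F : Type*} [AddCommGroup F] [Module A F] [Module.Free A F] (Ψ : O →ₗ[A] F)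
    (hΨ : Function.Injective Ψ) {E : Type*} [AddCommGroup E] [Module A E] [Module Q E]
    [IsScalarTower A Q E] [Module.Finite Q E] (Θ : O →ₗ[A] E) (hΘ : Function.Injective Θ) :
    Module.Finite A O := by
  classical
  let b := Module.Free.chooseBasis A F
  obtain ⟨T, hT, hTspan⟩ := Submodule.fg_span_iff_fg_span_finset_subset (R := Q) (Set.range Θ) |>.1
    (IsNoetherian.noetherian (Submodule.span Q (Set.range Θ)))
  have hT' : ∀ e ∈ T, ∃ o, Θ o = e := fun e he => hT he
  choose! σ hσ using hT'
  -- `J` collects the coordinates occurring in finitely many elements that span `O` over `Q`. Every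
  -- `o` has a nonzero multiple that is an `A`-combination of these, and `A` is a domain, so `o` is
  -- supported on `J` as well. Hence `O` embeds into the noetherian module `A^J`.
  let J : Finset (Module.Free.ChooseBasisIndex A F) := T.biUnion fun e => (b.repr (Ψ (σ e))).support
  have key : ∀ o : O, b.repr (Ψ o) ∈ Finsupp.supported A A (J : Set _) := by
    intro o
    have h1 : Θ o ∈ Submodule.span Q (T : Set E) := hTspan ▸ Submodule.subset_span ⟨o, rfl⟩
    obtain ⟨q, -, hq⟩ := Submodule.mem_span_finset.1 h1
    obtain ⟨⟨d, hd⟩, hint⟩ := IsLocalization.exist_integer_multiples A⁰ T q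
    choose! α hα using hint
    have h2 : d • o = ∑ e ∈ T, α e • σ e := by
      apply hΘ
      rw [map_smul, map_sum, ← hq, Finset.smul_sum]
      refine Finset.sum_congr rfl fun e he => ?_
      rw [map_smul, hσ e he, ← smul_assoc, ← algebraMap_smul Q (α e), hα e he]
    have h3 : d • b.repr (Ψ o) ∈ Finsupp.supported A A (J : Set _) := by
      rw [← map_smul, ← map_smul, h2, map_sum, map_sum]
      refine sum_mem fun e he => ?_
      rw [map_smul, map_smul]
      refine Submodule.smul_mem _ _ ((Finsupp.mem_supported A _).2 ?_)
      exact Finset.coe_subset.2 (Finset.subset_biUnion_of_mem (fun e => (b.repr (Ψ (σ e))).support) he)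
    rw [Finsupp.mem_supported'] at h3 ⊢
    intro i hi
    have h4 := h3 i hi
    rw [Finsupp.smul_apply, smul_eq_mul] at h4
    exact (mul_eq_zero.1 h4).resolve_left (nonZeroDivisors.ne_zero hd)
  let κ : O →ₗ[A] Finsupp.supported A A (J : Set (Module.Free.ChooseBasisIndex A F)) :=
    LinearMap.codRestrict _ (b.repr.toLinearMap ∘ₗ Ψ) key
  have : Module.Finite A (Finsupp.supported A A (J : Set (Module.Free.ChooseBasisIndex A F))) :=
    Module.Finite.equiv (Finsupp.supportedEquivFinsupp (R := A) (M := A)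
      (J : Set (Module.Free.ChooseBasisIndex A F))).symm
  have := isNoetherian_of_isNoetherianRing_of_finite A
    (Finsupp.supported A A (J : Set (Module.Free.ChooseBasisIndex A F)))
  refine Module.Finite.of_injective κ fun y z h => hΨ (b.repr.injective ?_)
  exact congrArg Subtype.val h

/-- An algebra of endomorphisms of a finitely generated projective module over a free
`A`-algebra `R` is finitely generated over `A` if it embeds into a finite-dimensional space. -/
lemma finite_of_injective_end {A : Type u} {Q : Type v} [CommRing A] [IsDomain A]
    [IsNoetherianRing A] [Field Q] [Algebra A Q] [IsFractionRing A Q] {O : Type w} [AddCommGroup O]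
    [Module A O] {R : Type*} [CommRing R] [Algebra A R] [Module.Free A R] {M : Type*}
    [AddCommGroup M] [Module R M] [Module.Finite R M] [Module.Projective R M]
    (i : O →+ Module.End R M) (hi : Function.Injective i)
    (hsmul : ∀ (a : A) (f : O) (m : M), i (a • f) m = algebraMap A R a • i f m)
    {E : Type*} [AddCommGroup E] [Module A E] [Module Q E]
    [IsScalarTower A Q E] [Module.Finite Q E] (Θ : O →ₗ[A] E) (hΘ : Function.Injective Θ) :
    Module.Finite A O := by
  obtain ⟨n, g, hg⟩ := Submodule.fg_iff_exists_fin_generating_family.1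
    (Module.Finite.fg_top (R := R) (M := M))
  obtain ⟨σ, hσ⟩ := Module.Projective.out (R := R) (P := M)
  -- An endomorphism is determined by its values on the generators `g k`; the section `σ` records
  -- them in a free `R`-module, which is free over `A`.
  let Ψ : O →ₗ[A] Fin n → M →₀ R :=
    { toFun := fun f k => σ (i f (g k))
      map_add' := fun f f' => by
        funext k
        rw [map_add, LinearMap.add_apply, map_add]; rfl
      map_smul' := fun a f => by
        funext k
        rw [hsmul, map_smul, algebraMap_smul]; rfl }
  refine finite_of_injective_free (Q := Q) Ψ (fun f f' h => hi ?_) Θ hΘ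
  refine LinearMap.ext_on_range hg fun k => ?_
  exact hσ.injective (congrFun h k)

variable {A : Type u} {Q : Type v} [CommRing A] [Field Q] [Algebra A Q]
  [IsFractionRing A Q] {O : Type w} [Ring O] [Algebra A O]

lemma inv_tmul_eq {a : A} (ha : a ≠ 0) {e : Q ⊗[A] O} {t : O} (h : a • e = 1 ⊗ₜ t) :
    e = (algebraMap A Q a)⁻¹ ⊗ₜ t := by
  have ha' : algebraMap A Q a ≠ 0 := by
    rwa [Ne, FaithfulSMul.algebraMap_eq_zero_iff]
  have h1 : (algebraMap A Q a)⁻¹ ⊗ₜ[A] t = (algebraMap A Q a)⁻¹ • (1 : Q) ⊗ₜ[A] t := by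
    rw [TensorProduct.smul_tmul', smul_eq_mul, mul_one]
  rw [h1, ← h, ← algebraMap_smul Q a, smul_smul, inv_mul_cancel₀ ha', one_smul]

lemma smul_inv_tmul {a : A} (ha : a ≠ 0) (t : O) :
    a • ((algebraMap A Q a)⁻¹ ⊗ₜ[A] t) = 1 ⊗ₜ t := by
  have ha' : algebraMap A Q a ≠ 0 := by
    rwa [Ne, FaithfulSMul.algebraMap_eq_zero_iff]
  rw [TensorProduct.smul_tmul', Algebra.smul_def, mul_inv_cancel₀ ha']

lemma inv_tmul_smul {a : A} (ha : a ≠ 0) (t : O) :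
    (algebraMap A Q a)⁻¹ ⊗ₜ[A] (a • t) = 1 ⊗ₜ t := by
  rw [← TensorProduct.smul_tmul, ← smul_inv_tmul (Q := Q) ha, TensorProduct.smul_tmul']

lemma one_tmul_injective [Module.Flat A O] : Function.Injective fun t : O => (1 : Q) ⊗ₜ[A] t :=
  Algebra.TensorProduct.includeRight_injective (FaithfulSMul.algebraMap_injective A Q)

/-- Closure of `S` under products, read on numerators: `(a⁻¹ t)(a⁻¹ t') = a⁻¹ y`. This is what makes
numerators act on the image submodule with values divisible by `a`. -/
lemma exists_mul_eq_smul [Module.Flat A O] {S : Subalgebra A (Q ⊗[A] O)} {a : A} (ha : a ≠ 0)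
    (hS : ∀ s ∈ S, ∃ t : O, s = (algebraMap A Q a)⁻¹ ⊗ₜ t) {t t' : O}
    (ht : (algebraMap A Q a)⁻¹ ⊗ₜ t ∈ S) (ht' : (algebraMap A Q a)⁻¹ ⊗ₜ t' ∈ S) :
    ∃ y, (algebraMap A Q a)⁻¹ ⊗ₜ y ∈ S ∧ t * t' = a • y := by
  obtain ⟨y, hy⟩ := hS _ (mul_mem ht ht')
  refine ⟨y, hy ▸ mul_mem ht ht', one_tmul_injective (Q := Q) (A := A) ?_⟩
  have h1 := congrArg (fun e => a • a • e) hy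
  simp only [smul_inv_tmul ha] at h1
  rw [← mul_smul_comm, ← smul_mul_assoc, smul_inv_tmul ha, smul_inv_tmul ha,
    Algebra.TensorProduct.tmul_mul_tmul, one_mul, ← TensorProduct.tmul_smul] at h1
  exact h1

variable [IsDomain A]

lemma exists_smul_eq_one_tmul (e : Q ⊗[A] O) : ∃ a : A, a ≠ 0 ∧ ∃ t : O, a • e = 1 ⊗ₜ t := by
  induction e using TensorProduct.induction_on with
  | zero => exact ⟨1, one_ne_zero, 0, by simp⟩
  | tmul q t =>
    obtain ⟨b, d, hd, rfl⟩ := IsFractionRing.div_surjective A q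
    refine ⟨d, nonZeroDivisors.ne_zero hd, b • t, ?_⟩
    have hd0 : algebraMap A Q d ≠ 0 := IsFractionRing.to_map_ne_zero_of_mem_nonZeroDivisors hd
    rw [TensorProduct.smul_tmul', Algebra.smul_def, mul_div_cancel₀ _ hd0, ← TensorProduct.smul_tmul,
      Algebra.smul_def, mul_one]
  | add e e' h h' =>
    obtain ⟨a, ha, t, ht⟩ := h
    obtain ⟨a', ha', t', ht'⟩ := h'
    refine ⟨a * a', mul_ne_zero ha ha', a' • t + a • t', ?_⟩
    rw [smul_add, mul_comm, mul_smul, ht, mul_comm, mul_smul, ht', TensorProduct.tmul_add,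
      TensorProduct.tmul_smul, TensorProduct.tmul_smul]

lemma exists_common_denominator (N : Submodule A (Q ⊗[A] O)) (hN : N.FG) :
    ∃ a : A, a ≠ 0 ∧ ∀ e ∈ N, ∃ t : O, a • e = 1 ⊗ₜ t := by
  induction N, hN using Submodule.fg_induction with
  | singleton e =>
    obtain ⟨a, ha, t, ht⟩ := exists_smul_eq_one_tmul e
    refine ⟨a, ha, fun e' he' => ?_⟩
    obtain ⟨d, rfl⟩ := Submodule.mem_span_singleton.1 he'
    exact ⟨d • t, by rw [smul_comm, ht, TensorProduct.tmul_smul]⟩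
  | sup N N' _ _ h h' =>
    obtain ⟨a, ha, h⟩ := h
    obtain ⟨a', ha', h'⟩ := h'
    refine ⟨a * a', mul_ne_zero ha ha', fun e he => ?_⟩
    obtain ⟨y, hy, z, hz, rfl⟩ := Submodule.mem_sup.1 he
    obtain ⟨t, ht⟩ := h y hy
    obtain ⟨t', ht'⟩ := h' z hz
    refine ⟨a' • t + a • t', ?_⟩
    rw [smul_add, mul_comm, mul_smul, ht, mul_comm, mul_smul, ht', TensorProduct.tmul_add,
      TensorProduct.tmul_smul, TensorProduct.tmul_smul]

variable [Module.Flat A O]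

/-- The elements of a finitely generated order have a common denominator `a`; the numerators form
a finitely generated module. -/
lemma IsOrder.exists_numerators [IsNoetherianRing A] {S : Subalgebra A (Q ⊗[A] O)}
    (hord : IsOrder A Q S) :
    ∃ (a : A) (n : ℕ) (t : Fin n → O), a ≠ 0 ∧
      (∀ s ∈ S, ∃ t : O, s = (algebraMap A Q a)⁻¹ ⊗ₜ t) ∧
      ∀ y, (algebraMap A Q a)⁻¹ ⊗ₜ y ∈ S ↔ y ∈ Submodule.span A (Set.range t) := by
  obtain ⟨a, ha, hS⟩ := exists_common_denominator (Subalgebra.toSubmodule S)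
    (Module.Finite.iff_fg.1 hord.finite)
  let φ : O →ₗ[A] Q ⊗[A] O := TensorProduct.mk A Q O (algebraMap A Q a)⁻¹
  let T : Submodule A O := (Subalgebra.toSubmodule S).comap φ
  let ψ : T →ₗ[A] S := φ.restrict (q := Subalgebra.toSubmodule S) fun y hy => hy
  have hψ : Function.Injective ψ := by
    intro y z h
    have h1 : (algebraMap A Q a)⁻¹ ⊗ₜ[A] (y : O) = (algebraMap A Q a)⁻¹ ⊗ₜ[A] (z : O) :=
      congrArg Subtype.val h
    have h2 := congrArg (a • ·) h1
    simp only [smul_inv_tmul ha] at h2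
    exact Subtype.ext (one_tmul_injective h2)
  have := hord.finite
  have : Module.Finite A T := Module.Finite.of_injective ψ hψ
  obtain ⟨n, t, ht⟩ := Submodule.fg_iff_exists_fin_generating_family.1
    (Module.Finite.iff_fg.1 this)
  refine ⟨a, n, t, ha, fun s hs => ?_, fun y => ?_⟩
  · obtain ⟨t, ht⟩ := hS s hs
    exact ⟨t, inv_tmul_eq ha ht⟩
  · rw [ht]; rfl

end Orders

/-! ### Dividing an endomorphism by `a` on the image submodule -/

section Divide

variable {R : Type u} [CommRing R]

lemma exists_divided {N : Type v} {M : Type w} [AddCommGroup N] [Module R N] [AddCommGroup M]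
    [Module R M] (j : N →ₗ[R] M) {a : R} (ha : ∀ n, a • j n = 0 → n = 0) (F : N →ₗ[R] M)
    (hF : ∀ n, ∃ n', a • j n' = F n) : ∃ h : N →ₗ[R] N, ∀ n, a • j (h n) = F n := by
  have hinj : Function.Injective (a • j) := (injective_iff_map_eq_zero _).2 ha
  refine ⟨(LinearEquiv.ofInjective (a • j) hinj).symm.toLinearMap ∘ₗ
    LinearMap.codRestrict _ F hF, fun n => ?_⟩
  exact congrArg Subtype.val
    ((LinearEquiv.ofInjective (a • j) hinj).apply_symm_apply (LinearMap.codRestrict _ F hF n))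

/-- Since `a` is fixed by `s` and can be cancelled, it suffices to compare after multiplying by `a`;
there `a h` becomes the restriction of `y`, which commutes with `τ`. -/
lemma divided_tau {s : R →+* R} {N : Type v} {M : Type w} [AddCommGroup N] [Module R N]
    [AddCommGroup M] [Module R M] {τ : Pullback s M →ₗ[R] M} {τ' : Pullback s N →ₗ[R] N}
    (j : N →ₗ[R] M) (hj : ∀ z, j (τ' z) = τ (Pullback.map s j z)) {a : R}
    (ha : ∀ n, a • j n = 0 → n = 0) (hsa : s a = a) {y : Module.End R M}
    (hy : ∀ z, y (τ z) = τ (Pullback.map s y z)) {h : N →ₗ[R] N}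
    (hh : ∀ n, a • j (h n) = y (j n)) (z) : h (τ' z) = τ' (Pullback.map s h z) := by
  rw [← sub_eq_zero]
  refine ha _ ?_
  rw [map_sub, smul_sub, sub_eq_zero, hh, hj, hy, hj, Pullback.map_comp, Pullback.map_comp,
    ← map_smul]
  congr 1
  conv_rhs => rw [← hsa, ← Pullback.map_algebraMap, Pullback.map_comp]
  congr 1
  congr 1
  exact LinearMap.ext fun n => (hh n).symm

lemma exists_smul_eq_apply {M : Type v} [AddCommGroup M] [Module R M] {ι : Type w}
    {t : ι → Module.End R M} {a : R} {y : Module.End R M}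
    (hy : ∀ i, ∃ z : Module.End R M, (∀ m, z m ∈ imageModule t) ∧ ∀ m, y (t i m) = a • z m)
    (n : imageModule t) : ∃ n' : imageModule t,
      a • (imageModule t).subtype n' = (y ∘ₗ (imageModule t).subtype) n := by
  induction n using imageModule_induction with
  | h0 => exact ⟨0, by rw [map_zero, map_zero, smul_zero]⟩
  | hadd n n' hn hn' =>
    obtain ⟨b, hb⟩ := hn
    obtain ⟨b', hb'⟩ := hn'
    exact ⟨b + b', by rw [map_add, smul_add, hb, hb', map_add]⟩
  | ht i m =>
    obtain ⟨z, hz, hyz⟩ := hy i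
    exact ⟨⟨z m, hz m⟩, (hyz m).symm⟩

lemma exists_divided_imageModule {M : Type v} [AddCommGroup M] [Module R M] {ι : Type w}
    {t : ι → Module.End R M} {a : R} (ha : ∀ m : M, a • m = 0 → m = 0) {y : Module.End R M}
    (hy : ∀ i, ∃ z : Module.End R M, (∀ m, z m ∈ imageModule t) ∧ ∀ m, y (t i m) = a • z m) :
    ∃ h : imageModule t →ₗ[R] imageModule t,
      ∀ n, a • (imageModule t).subtype (h n) = y ((imageModule t).subtype n) :=
  exists_divided (imageModule t).subtype (fun n hn => Subtype.ext (ha n hn))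
    (y ∘ₗ (imageModule t).subtype) (exists_smul_eq_apply hy)

end Divide

/-! ### Conjugation as the algebra homomorphism `h ↦ a⁻¹ ⊗ φ h` -/

section InvTmul

variable {A : Type u} {Q : Type v} [CommRing A] [Field Q] [Algebra A Q] [IsFractionRing A Q]
  {O : Type w} [Ring O] [Algebra A O] {O' : Type x} [Ring O'] [Algebra A O'] {a : A} (ha : a ≠ 0)
  (φ : O' →ₗ[A] O) (h1 : φ 1 = a • 1) (hmul : ∀ h h', φ h * φ h' = a • φ (h * h'))

variable (Q) in
/-- The homomorphism `h ↦ a⁻¹ ⊗ φ h`. -/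
def invTmulAlgHom : O' →ₐ[A] Q ⊗[A] O :=
  AlgHom.ofLinearMap (TensorProduct.mk A Q O (algebraMap A Q a)⁻¹ ∘ₗ φ)
    (by rw [LinearMap.comp_apply, h1, TensorProduct.mk_apply, inv_tmul_smul ha]; rfl)
    (fun h h' => by
      simp only [LinearMap.comp_apply, TensorProduct.mk_apply]
      rw [Algebra.TensorProduct.tmul_mul_tmul, hmul, ← TensorProduct.smul_tmul, Algebra.smul_def,
        mul_inv_cancel_left₀]
      rwa [Ne, FaithfulSMul.algebraMap_eq_zero_iff])

lemma invTmulAlgHom_apply (h : O') :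
    invTmulAlgHom Q ha φ h1 hmul h = (algebraMap A Q a)⁻¹ ⊗ₜ φ h := rfl

lemma invTmulAlgHom_injective [Module.Flat A O] (hφ : Function.Injective φ) :
    Function.Injective (invTmulAlgHom Q ha φ h1 hmul) := by
  intro h h' e
  have e1 := congrArg (a • ·) e
  simp only [invTmulAlgHom_apply, smul_inv_tmul ha] at e1
  exact hφ (one_tmul_injective e1)

lemma inv_tmul_eq_inv_tmul {a a' : A} (ha : a ≠ 0) (ha' : a' ≠ 0) {t t' : O}
    (h : a • t = a' • t') : (algebraMap A Q a')⁻¹ ⊗ₜ[A] t = (algebraMap A Q a)⁻¹ ⊗ₜ[A] t' := by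
  refine inv_tmul_eq ha ?_
  rw [← TensorProduct.tmul_smul, h, inv_tmul_smul ha']

end InvTmul

/-! ### A criterion for a larger ring to be an order -/

section OrderFinite

variable {A : Type u} {Q : Type v} [CommRing A] [Field Q] [Algebra A Q]
  {O : Type w} [Ring O] [Algebra A O] {S : Subalgebra A (Q ⊗[A] O)}

lemma IsOrder.finite_fractionField (hS : IsOrder A Q S) : Module.Finite Q (Q ⊗[A] O) := by
  have h1 : Module.Finite A (Subalgebra.toSubmodule S) := hS.finite
  obtain ⟨T, hT⟩ := Module.Finite.iff_fg.1 h1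
  refine ⟨T, ?_⟩
  rw [← hS.span_eq_top, ← Submodule.span_span_of_tower A Q (T : Set (Q ⊗[A] O)), hT]
  rfl

/-- Spanning over `Q` is inherited from `S`, so only finite generation is at stake. It follows from
the faithful action on `M`, while the finite dimension of `Q ⊗ O` is itself a consequence of the
order `S`. -/
lemma IsOrder.of_le_range [IsDomain A] [IsNoetherianRing A] [IsFractionRing A Q]
    (hS : IsOrder A Q S) {O' : Type x} [Ring O'] [Algebra A O'] {R : Type*} [CommRing R]
    [Algebra A R] [Module.Free A R] {M : Type*} [AddCommGroup M] [Module R M] [Module.Finite R M]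
    [Module.Projective R M] (i : O' →+ Module.End R M) (hi : Function.Injective i)
    (hsmul : ∀ (a : A) (f : O') (m : M), i (a • f) m = algebraMap A R a • i f m)
    (Φ : O' →ₐ[A] Q ⊗[A] O) (hΦ : Function.Injective Φ) (hle : S ≤ Φ.range) :
    IsOrder A Q Φ.range := by
  have := hS.finite_fractionField
  have : Module.Finite A O' := finite_of_injective_end (Q := Q) i hi hsmul Φ.toLinearMap hΦ
  refine ⟨Module.Finite.of_surjective Φ.rangeRestrict.toLinearMap Φ.rangeRestrict_surjective, ?_⟩
  rw [eq_top_iff, ← hS.span_eq_top]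
  exact Submodule.span_mono hle

end OrderFinite

/-! ### Conjugation of endomorphism rings by an isogeny -/

section Conjugation

variable {Fq : Type u} {Q : Type v} [Field Fq] [Field Q] [Algebra Fq Q] [Fintype Fq]
variable {inf : Place Fq Q} {L : Type w} [Field L] [Algebra Fq L]
variable {c : regularAway inf →ₐ[Fq] L}

lemma End.smul_apply {M : PureMotive.{u, v, w, x} c} (a : regularAway inf) (f : End M)
    (m : M.carrier) : (a • f).1 m = (a ⊗ₜ[Fq] (1 : L) : AL inf L) • f.1 m := rfl

lemma End.isTorsionFree [IsDomain (regularAway inf)] (M : PureMotive.{u, v, w, x} c) :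
    Module.IsTorsionFree (regularAway inf) (End M) := by
  rw [Module.isTorsionFree_iff_smul_eq_zero]
  intro a f h
  rw [or_iff_not_imp_left]
  intro ha
  refine Subtype.ext (LinearMap.ext fun m => M.smul_eq_zero ha _ ?_)
  rw [← End.smul_apply, h]
  rfl

lemma End.flat [IsDedekindDomain (regularAway inf)] (M : PureMotive.{u, v, w, x} c) :
    Module.Flat (regularAway inf) (End M) := by
  have := End.isTorsionFree M
  infer_instance

variable {M' M : PureMotive.{u, v, w, x} c} {f : M'.carrier →ₗ[AL inf L] M.carrier}
  {g : M.carrier →ₗ[AL inf L] M'.carrier} (hf : IsMorphism M' M f) (hg : IsMorphism M M' g)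

/-- The map `h ↦ f ∘ h ∘ g`. -/
def conjHom : End M' →ₗ[regularAway inf] End M where
  toFun h := ⟨f ∘ₗ h.1 ∘ₗ g, isMorphism_iff.2 fun y => by
    have h1 := isMorphism_iff.1 hg y
    have h2 := isMorphism_iff.1 h.2 (Pullback.map _ g y)
    have h3 := isMorphism_iff.1 hf (Pullback.map _ h.1 (Pullback.map _ g y))
    rw [LinearMap.comp_apply, LinearMap.comp_apply, h1, h2, h3, Pullback.map_comp,
      Pullback.map_comp]
    rfl⟩
  map_add' h h' := Subtype.ext (LinearMap.ext fun m => map_add f _ _)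
  map_smul' a h := Subtype.ext (LinearMap.ext fun m => map_smul f _ _)

lemma conjHom_apply (h : End M') (m : M.carrier) : (conjHom hf hg h).1 m = f (h.1 (g m)) := rfl

variable {a : regularAway inf} (ha : a ≠ 0)
  (hfg : ∀ m, f (g m) = (a ⊗ₜ[Fq] (1 : L) : AL inf L) • m)
  (hgf : ∀ m, g (f m) = (a ⊗ₜ[Fq] (1 : L) : AL inf L) • m)

include ha hgf in
lemma conjHom_injective [IsDomain (regularAway inf)] (hinj : Function.Injective f) :
    Function.Injective (conjHom hf hg) := by
  refine (injective_iff_map_eq_zero _).2 fun h hh => Subtype.ext (LinearMap.ext fun m => ?_)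
  refine M'.smul_eq_zero ha _ ?_
  rw [← map_smul, ← hgf]
  refine hinj ?_
  rw [← conjHom_apply hf hg, hh, map_zero]
  rfl

omit ha in
include hfg in
lemma conjHom_one : conjHom hf hg 1 = a • (1 : End M) :=
  Subtype.ext (LinearMap.ext fun m => hfg m)

omit ha in
include hgf in
lemma conjHom_mul (h h' : End M') :
    conjHom hf hg h * conjHom hf hg h' = a • conjHom hf hg (h * h') := by
  refine Subtype.ext (LinearMap.ext fun m => ?_)
  change f (h.1 (g (f (h'.1 (g m))))) = _
  rw [hgf, map_smul, map_smul]
  rfl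

/-- The homomorphism `h ↦ f ∘ h ∘ f⁻¹`, where `f⁻¹ = a⁻¹ ⊗ g`. -/
def conjAlgHom [IsFractionRing (regularAway inf) Q] : End M' →ₐ[regularAway inf] QEnd M :=
  invTmulAlgHom Q ha (conjHom hf hg) (conjHom_one hf hg hfg) (conjHom_mul hf hg hgf)

/-- `conjEnd` allows every pair `(a', g')`. Injectivity of `f` forces `a g' = a' g`, so the
resulting fractions agree and one fixed pair suffices. -/
lemma conjEnd_eq_range [IsFractionRing (regularAway inf) Q] (hinj : Function.Injective f) :
    conjEnd f = (conjAlgHom hf hg ha hfg hgf).range := by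
  refine Set.Subset.antisymm ?_ ?_
  · rintro _ ⟨a', g', h, t, ha', hg', hfg', hgf', ht, rfl⟩
    refine ⟨h, ?_⟩
    have h1 : a • t = a' • conjHom hf hg h := by
      refine Subtype.ext (LinearMap.ext fun m => ?_)
      have key : (a ⊗ₜ[Fq] (1 : L) : AL inf L) • g' m = (a' ⊗ₜ[Fq] (1 : L) : AL inf L) • g m :=
        hinj (by rw [map_smul, map_smul, hfg, hfg', smul_comm])
      rw [End.smul_apply, End.smul_apply, ht]
      change _ • f (h.1 (g' m)) = _ • f (h.1 (g m))
      rw [← map_smul f, ← map_smul f, ← map_smul h.1, ← map_smul h.1, key]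
    exact (inv_tmul_eq_inv_tmul ha ha' h1).symm
  · rintro _ ⟨h, rfl⟩
    exact ⟨a, g, h, conjHom hf hg h, ha, hg, hfg, hgf, rfl, rfl⟩

lemma conjAlgHom_injective [IsDedekindDomain (regularAway inf)]
    [IsFractionRing (regularAway inf) Q] (hinj : Function.Injective f) :
    Function.Injective (conjAlgHom hf hg ha hfg hgf) :=
  have := End.flat M
  invTmulAlgHom_injective ha _ _ _ (conjHom_injective hf hg ha hgf hinj)

lemma isOrder_range_conjAlgHom [IsDedekindDomain (regularAway inf)]
    [IsFractionRing (regularAway inf) Q] (hinj : Function.Injective f)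
    {S : Subalgebra (regularAway inf) (QEnd M)} (hS : IsOrder (regularAway inf) Q S)
    (hle : S ≤ (conjAlgHom hf hg ha hfg hgf).range) :
    IsOrder (regularAway inf) Q (conjAlgHom hf hg ha hfg hgf).range :=
  have := M'.finite
  have := M'.projective
  hS.of_le_range (R := AL inf L) (M := M'.carrier) (End M').subtype.toAddMonoidHom
    Subtype.val_injective (fun _ _ _ => rfl) _ (conjAlgHom_injective hf hg ha hfg hgf hinj) hle

end Conjugation

/-! ### The isogeny attached to an order -/

section MaximalOrder

variable {Fq : Type u} {Q : Type v} [Field Fq] [Field Q] [Algebra Fq Q] [Fintype Fq]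
variable {inf : Place Fq Q} {L : Type w} [Field L] [Algebra Fq L]
variable {c : regularAway inf →ₐ[Fq] L} {M : PureMotive.{u, v, w, x} c}

lemma apply_mem_imageModule {ι : Type} {t : ι → End M} {y : End M}
    (hy : y ∈ Submodule.span (regularAway inf) (Set.range t)) (m : M.carrier) :
    y.1 m ∈ imageModule fun i => (t i).1 := by
  induction hy using Submodule.span_induction with
  | mem y hy =>
    obtain ⟨i, rfl⟩ := hy
    exact (toImage (fun i => (t i).1) i m).2
  | zero => exact zero_mem _
  | add y z _ _ hy hz => exact add_mem hy hz
  | smul a y _ hy => exact Submodule.smul_mem _ _ hy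

lemma isTorsion_quotient_of_smul_mem [IsDomain (regularAway inf)] {N : Submodule (AL inf L) M.carrier}
    {a : regularAway inf} (ha : a ≠ 0)
    (hN : ∀ m : M.carrier, (a ⊗ₜ[Fq] (1 : L) : AL inf L) • m ∈ N) :
    Module.IsTorsion (AL inf L) (M.carrier ⧸ N) := by
  intro y
  obtain ⟨m, rfl⟩ := Submodule.mkQ_surjective _ y
  refine ⟨⟨(a ⊗ₜ[Fq] (1 : L) : AL inf L), ?_⟩, (Submodule.Quotient.mk_eq_zero _).2 (hN m)⟩
  refine mem_nonZeroDivisors_iff_right.2 fun r hr => ?_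
  exact smul_eq_zero_of_projective (A := regularAway inf) (R := AL inf L) (M := AL inf L)
    inferInstance ha ((mul_comm _ _).trans hr)

variable {ι : Type} [Finite ι] {t : ι → End M} {a : regularAway inf} (ha : a ≠ 0)
  (hat : ∀ m : M.carrier, (a ⊗ₜ[Fq] (1 : L) : AL inf L) • m ∈ imageModule fun i => (t i).1)
  (hQ : IsCurveFunctionField Fq Q)

lemma isIsogeny_imageMotive [IsDomain (regularAway inf)] :
    IsIsogeny (imageMotive M hat hQ ha) M (imageModule fun i => (t i).1).subtype where
  isMorphism := isMorphism_iff.2 (subtype_imageTau (fun i => (t i).1) M.τ fun i => End.apply_tau (t i))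
  injective := Submodule.subtype_injective _
  torsion_coker := isTorsion_quotient_of_smul_mem ha fun m => ⟨⟨_, hat m⟩, rfl⟩

lemma isMorphism_mulToImage : IsMorphism M (imageMotive M hat hQ ha) (mulToImage hat) :=
  isMorphism_iff.2 (mulToImage_tau M.τ (fun i => End.apply_tau (t i)) hat
    ((frob_tmul a (1 : L)).trans (by rw [one_pow])))

/-- An endomorphism `y` which maps the submodule generated by the images into its multiple by `a`
is of the form `f ∘ h ∘ (a f⁻¹)`. -/
lemma exists_conjHom_eq [IsDomain (regularAway inf)] {y : End M}
    (hy : ∀ i, ∃ z ∈ Submodule.span (regularAway inf) (Set.range t), y * t i = a • z) :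
    ∃ h, conjHom (isIsogeny_imageMotive ha hat hQ).isMorphism
      (isMorphism_mulToImage ha hat hQ) h = y := by
  have hcancel : ∀ n : imageModule fun i => (t i).1,
      (a ⊗ₜ[Fq] (1 : L) : AL inf L) • (imageModule fun i => (t i).1).subtype n = 0 → n = 0 :=
    fun n hn => Subtype.ext (M.smul_eq_zero ha _ hn)
  have hy' : ∀ i, ∃ z : Module.End (AL inf L) M.carrier,
      (∀ m, z m ∈ imageModule fun i => (t i).1) ∧
        ∀ m, y.1 ((t i).1 m) = (a ⊗ₜ[Fq] (1 : L) : AL inf L) • z m := fun i => by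
    obtain ⟨z, hz, hyz⟩ := hy i
    refine ⟨z.1, apply_mem_imageModule hz, fun m => ?_⟩
    rw [← End.smul_apply, ← hyz]
    rfl
  obtain ⟨h, hh⟩ := exists_divided_imageModule (M.smul_eq_zero ha) hy'
  have hmor : IsMorphism (imageMotive M hat hQ ha) (imageMotive M hat hQ ha) h :=
    isMorphism_iff.2 fun z => divided_tau (τ := M.τ)
      (τ' := imageTau (fun i => (t i).1) M.τ fun i => End.apply_tau (t i))
      (imageModule fun i => (t i).1).subtype
      (subtype_imageTau (fun i => (t i).1) M.τ fun i => End.apply_tau (t i)) hcancel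
      ((frob_tmul a (1 : L)).trans (by rw [one_pow])) (End.apply_tau y) hh z
  refine ⟨⟨h, hmor⟩, Subtype.ext (LinearMap.ext fun m => ?_)⟩
  rw [← sub_eq_zero]
  refine M.smul_eq_zero ha _ ?_
  rw [smul_sub, sub_eq_zero]
  refine (hh (mulToImage hat m)).trans ?_
  exact map_smul y.1 (a ⊗ₜ[Fq] (1 : L) : AL inf L) m

end MaximalOrder

end AndersonMotive

end

/-! ### Conclusion -/

theorem theorem9p9 {Fq : Type u} {Q : Type v} {L : Type w}
    [Field Fq] [Fintype Fq] [Field Q] [Algebra Fq Q] [Field L] [Algebra Fq L]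
    (hQ : AndersonMotive.IsCurveFunctionField Fq Q)
    (inf : AndersonMotive.Place Fq Q) (hinf : inf.IsRational)
    (c : AndersonMotive.regularAway inf →ₐ[Fq] L)
    (M : AndersonMotive.PureMotive.{u, v, w, x} c)
    (S : Subalgebra (AndersonMotive.regularAway inf) (AndersonMotive.QEnd M))
    (hS : Maximal (AndersonMotive.IsOrder (AndersonMotive.regularAway inf) Q) S) :
    ∃ (M' : AndersonMotive.PureMotive.{u, v, w, x} c)
      (f : M'.carrier →ₗ[AndersonMotive.AL inf L] M.carrier),
      AndersonMotive.IsIsogeny M' M f ∧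
        AndersonMotive.conjEnd f = (S : Set (AndersonMotive.QEnd M)) := by
  open AndersonMotive in
  have := isDedekindDomain_regularAway hQ inf
  have := isFractionRing_regularAway hQ inf
  have := End.flat M
  obtain ⟨a, n, t, ha, hden, hnum⟩ := hS.1.exists_numerators
  -- The numerator of `1 ∈ S` is `a`, so `a M` lies in the sum of the images.
  have hat : ∀ m : M.carrier,
      (a ⊗ₜ[Fq] (1 : L) : AL inf L) • m ∈ imageModule fun i => (t i).1 := by
    have h1 : a • (1 : End M) ∈ Submodule.span (regularAway inf) (Set.range t) := by
      rw [← hnum, inv_tmul_smul ha]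
      exact one_mem S
    exact fun m => apply_mem_imageModule h1 m
  have hiso := isIsogeny_imageMotive ha hat hQ
  have hrange := conjEnd_eq_range hiso.isMorphism (isMorphism_mulToImage ha hat hQ) ha
    (fun _ => rfl) (fun _ => rfl) hiso.injective
  have hle : S ≤ (conjAlgHom hiso.isMorphism (isMorphism_mulToImage ha hat hQ) ha
      (fun _ => rfl) (fun _ => rfl)).range := by
    intro s hs
    obtain ⟨y, rfl⟩ := hden s hs
    -- As `S` is a ring, `y tᵢ = a z` with `z` again a numerator; so `y` maps the submodule into its
    -- multiple by `a` and can be divided by `a` there.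
    obtain ⟨h, hh⟩ := exists_conjHom_eq ha hat hQ (y := y) fun i => by
      obtain ⟨z, hz, hyz⟩ := exists_mul_eq_smul ha hden hs
        ((hnum (t i)).2 (Submodule.subset_span ⟨i, rfl⟩))
      exact ⟨z, (hnum z).1 hz, hyz⟩
    exact ⟨h, congrArg (TensorProduct.mk (regularAway inf) Q (End M) _) hh⟩
  refine ⟨imageMotive M hat hQ ha, _, hiso, hrange.trans (congrArg SetLike.coe ?_)⟩
  -- The conjugated endomorphism ring is an order containing `S`, so maximality gives the reverse
  -- inclusion.
  exact le_antisymm (hS.2 (isOrder_range_conjAlgHom hiso.isMorphism _ ha _ _ hiso.injective hS.1 hle)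
    hle) hle
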